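/- Let $(X,d,\mu)$ be a metric measure space, i.e. $(X,d)$ is a metric space and $\mu$ is a non-negative Borel measure with $0<\mu(B(x,r))<\infty$ for all $x\in X$, $r\in(0,\infty)$, where $B(x,r)=\{y\in X: d(x,y)<r\}$. **Exponents.** $\mathcal P(X)$ is the set of measurable $q:X\to(0,\infty]$ with $\operatorname{ess\,inf}_X q>0$; $\mathcal P_b(X)$ is the set of essentially bounded $q\in\mathcal P(X)$; and $\mathcal P_b^{\log}(X)$ is the set of $p\in\mathcal P_b(X)$ for which there is $C>0$ with $$\Big|\tfrac1{p(x)}-\tfrac1{p(y)}\Big|\le \frac{C}{\log(e+1/d(x,y))}\qquad\text{for all distinct } x,y\in X .$$ For exponents $f,g$ we write $f\ll g$ if $\operatorname{ess\,inf}_X(g-f)>0$, and $f\le g$ if $f(x)\le g(x)$ for all $x\in X$. **Lebesgue and mixed spaces.** For $p\in\mathcal P_b(X)$ put $\rho_{p(\cdot)}(f)=\int_X|f(x)|^{p(x)}\,d\mu(x)$ and $\|f\|_{L^{p(\cdot)}}=\inf\{\lambda>0:\rho_{p(\cdot)}(f/\lambda)\le1\}$ (with $\inf\emptyset=\infty$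 throughout); $L^{p(\cdot)}(X,\mu)$ is the space of measurable, extended real-valued $f$ with $\rho_{p(\cdot)}(f)<\infty$ (such $f$ are finite a.e.). For $q\in\mathcal P(X)$ and a sequence $g=\{g_k\}_{k\in\mathbb Z}$ of measurable functions $g_k:X\to[0,\infty]$ put $$\|g\|_{L^{p(\cdot)}(\ell^{q(\cdot)})}=\Big\|\,x\mapsto\|\{g_k(x)\}_{k\in\mathbb Z}\|_{\ell^{q(x)}}\Big\|_{L^{p(\cdot)}},$$ $$\|g\|_{\ell^{q(\cdot)}(L^{p(\cdot)})}=\inf\Big\{\lambda>0:\ \sum_{k\in\mathbb Z}\inf\Big\{\lambda_k>0:\rho_{p(\cdot)}\Big(\frac{g_k}{\lambda\,\lambda_k^{1/q(\cdot)}}\Big)\le1\Big\}\le1\Big\},$$ where $\lambda_k^{1/\infty}:=1$. **Hajłasz-type spaces.** Let $s,p\in\mathcal P_b(X)$ and $q\in\mathcal P(X)$. For a measurable, a.e. finite $u:X\to[-\infty,\infty]$ let $\mathbb D^{s(\cdot)}(u)$ be the set of all sequences $\{g_k\}_{k\in\mathbb Z}$ of measurable functions $g_k:X\to[0,\infty]$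 for which there is a $\mu$-null set $N$ such that $$|u(x)-u(y)|\le d(x,y)^{s(x)}g_k(x)+d(x,y)^{s(y)}g_k(y)$$ for all $k\in\mathbb Z$ and all $x,y\in X\setminus N$ with $2^{-k-1}\le d(x,y)<2^{-k}$. Let $M^{s(\cdot)}_{p(\cdot),q(\cdot)}(X,d,\mu)$ and $N^{s(\cdot)}_{p(\cdot),q(\cdot)}(X,d,\mu)$ be the spaces of those $u\in L^{p(\cdot)}(X,\mu)$ for which, respectively, $$\|u\|_{M^{s(\cdot)}_{p(\cdot),q(\cdot)}}:=\|u\|_{L^{p(\cdot)}}+\inf_{g\in\mathbb D^{s(\cdot)}(u)}\|g\|_{L^{p(\cdot)}(\ell^{q(\cdot)})}<\infty,\qquad \|u\|_{N^{s(\cdot)}_{p(\cdot),q(\cdot)}}:=\|u\|_{L^{p(\cdot)}}+\inf_{g\in\mathbb D^{s(\cdot)}(u)}\|g\|_{\ell^{q(\cdot)}(L^{p(\cdot)})}<\infty .$$ For two such spaces, $E\hookrightarrow F$ means that $E\subseteq F$ and that there is a finite constant $C$ with $\|u\|_F\le C\|u\|_E$ for all $u\in E$. **Theorem.** Suppose that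 * $(X,d)$ is geometrically doubling: there is $M$ such that every ball $B(x,r)$ can be covered by at most $M$ balls of radius $r/2$; * there is $\delta\in(0,\infty)$ with $\sup_{x\in X}\mu(B(x,\delta))<\infty$; * $\mu$ is lower Ahlfors $Q(\cdot)$-regular for some $Q\in\mathcal P_b^{\log}(X)$: there is $b>0$ with $\mu(B(x,r))\ge b\,r^{Q(x)}$ for all $x\in X$ and $r\in(0,1]$. Let $p,s\in\mathcal P_b^{\log}(X)$ satisfy $sp\ll Q$, and put $\gamma:=\dfrac{Qp}{Q-sp}$. Then: 1. for every $q\in\mathcal P(X)$, $\;M^{s(\cdot)}_{p(\cdot),q(\cdot)}(X,d,\mu)\hookrightarrow L^{\gamma(\cdot)}(X,\mu)$; 2. for every $q\in\mathcal P(X)$ with $q\le p$, $\;N^{s(\cdot)}_{p(\cdot),q(\cdot)}(X,d,\mu)\hookrightarrow L^{\gamma(\cdot)}(X,\mu)$; 3. for every $q\in\mathcal P(X)$ and every $t\in\mathcal P_b^{\log}(X)$ with $t\ll s$, $\;N^{s(\cdot)}_{p(\cdot),q(\cdot)}(X,d,\mu)\hookrightarrow L^{\sigma(\cdot)}(X,\mu)$,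 where $\sigma:=\dfrac{Qp}{Q-tp}$. -/

import Mathlib

open MeasureTheory Set Filter
open scoped ENNReal

namespace VarHajlasz

/-! ### Geometry of metric measure spaces -/

section Geometry

/-- `(X, d, μ)` is a metric measure space: every ball of positive (finite) radius has positive and
finite measure. -/
def IsMetricMeasureSpace {X : Type*} [MetricSpace X] [MeasurableSpace X]
    (μ : Measure X) : Prop :=
  ∀ (x : X) (r : ℝ), 0 < r → 0 < μ (Metric.ball x r) ∧ μ (Metric.ball x r) < ∞

/-- `X` is geometrically doubling: there is `M` such that every ball of radius `r` can be covered
by at most `M` balls of radius `r / 2`. -/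
def GeometricallyDoubling (X : Type*) [MetricSpace X] : Prop :=
  ∃ M : ℕ, ∀ (x : X) (r : ℝ), 0 < r →
    ∃ S : Finset X, S.card ≤ M ∧ Metric.ball x r ⊆ ⋃ y ∈ S, Metric.ball y (r / 2)

/-- `μ` is lower Ahlfors `Q(·)`-regular. -/
def LowerAhlforsRegular {X : Type*} [MetricSpace X] [MeasurableSpace X]
    (Q : X → ℝ) (μ : Measure X) : Prop :=
  ∃ b : ℝ, 0 < b ∧ ∀ (x : X) (r : ℝ), 0 < r → r ≤ 1 →
    ENNReal.ofReal (b * r ^ Q x) ≤ μ (Metric.ball x r)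

end Geometry

/-! ### Variable exponents -/

section Exponents

/-- The class `𝒫(X)` of variable exponents `q : X → (0, ∞]` with `ess inf q > 0`. -/
structure IsExponent {X : Type*} [MeasurableSpace X] (q : X → ℝ≥0∞) (μ : Measure X) : Prop where
  measurable : Measurable q
  pos : ∀ x, 0 < q x
  essInf_pos : 0 < essInf q μ

/-- Local log-Hölder continuity of a real function on `X`. (For `x = y` the inequality
is trivially true.) -/
def LogHolder {X : Type*} [MetricSpace X] (f : X → ℝ) : Prop :=
  ∃ C : ℝ, 0 < C ∧ ∀ x y : X, |f x - f y| ≤ C / Real.log (Real.exp 1 + 1 / dist x y)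

/-- The class `𝒫_b^log(X)`: essentially bounded variable exponents `p` such that `1 / p` is locally
log-Hölder continuous. On a space in which all balls have positive measure such an exponent is
finite everywhere, hence it is taken real-valued. -/
structure IsBddLogExponent {X : Type*} [MetricSpace X] [MeasurableSpace X]
    (p : X → ℝ) (μ : Measure X) : Prop where
  measurable : Measurable p
  pos : ∀ x, 0 < p x
  essInf_pos : 0 < essInf (fun x => ENNReal.ofReal (p x)) μ
  essSup_lt_top : essSup (fun x => ENNReal.ofReal (p x)) μ < ∞
  logHolder : LogHolder (fun x => 1 / p x)

/-- `f ≪ g`, that is, `ess inf (g - f) > 0`. -/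
def MuchLess {X : Type*} [MeasurableSpace X] (f g : X → ℝ) (μ : Measure X) : Prop :=
  0 < essInf (fun x => ((g x - f x : ℝ) : EReal)) μ

end Exponents

/-! ### Variable Lebesgue and mixed Lebesgue-sequence spaces

The modulars and Luxemburg quasi-norms only involve absolute values of functions, so they are
defined for functions with values in `[0, ∞]`. -/

section Lebesgue

variable {X : Type*} [MeasurableSpace X]

/-- The modular `ρ_{p(·)}(f) = ∫ f(x)^{p(x)} dμ(x)`. -/
noncomputable def modular (p : X → ℝ) (μ : Measure X) (f : X → ℝ≥0∞) : ℝ≥0∞ :=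
  ∫⁻ x, f x ^ p x ∂μ

/-- The Luxemburg quasi-norm of `L^{p(·)}(X, μ)`. -/
noncomputable def lebNorm (p : X → ℝ) (μ : Measure X) (f : X → ℝ≥0∞) : ℝ≥0∞ :=
  sInf {l : ℝ≥0∞ | 0 < l ∧ l < ∞ ∧ modular p μ (fun x => f x / l) ≤ 1}

/-- The pointwise `ℓ^{q(x)}`-quasi-norm of a sequence indexed by `ℤ`, as a function of `x`. -/
noncomputable def seqNorm (q : X → ℝ≥0∞) (g : ℤ → X → ℝ≥0∞) (x : X) : ℝ≥0∞ :=
  if q x = ∞ then ⨆ k, g k x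
  else (∑' k, g k x ^ (q x).toReal) ^ (1 / (q x).toReal)

/-- The quasi-norm of `L^{p(·)}(ℓ^{q(·)}(X, μ))`. -/
noncomputable def lebSeqNorm (p : X → ℝ) (q : X → ℝ≥0∞) (μ : Measure X)
    (g : ℤ → X → ℝ≥0∞) : ℝ≥0∞ :=
  lebNorm p μ (seqNorm q g)

/-- The modular of `ℓ^{q(·)}(L^{p(·)}(X, μ))`; note that `(q x)⁻¹ = 0`, so that
`l ^ (1 / q x) = 1`, where `q x = ∞`. -/
noncomputable def seqLebModular (p : X → ℝ) (q : X → ℝ≥0∞) (μ : Measure X)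
    (g : ℤ → X → ℝ≥0∞) : ℝ≥0∞ :=
  ∑' k, sInf {l : ℝ≥0∞ | 0 < l ∧ l < ∞ ∧
    modular p μ (fun x => g k x / l ^ ((q x)⁻¹).toReal) ≤ 1}

/-- The quasi-norm of `ℓ^{q(·)}(L^{p(·)}(X, μ))`. -/
noncomputable def seqLebNorm (p : X → ℝ) (q : X → ℝ≥0∞) (μ : Measure X)
    (g : ℤ → X → ℝ≥0∞) : ℝ≥0∞ :=
  sInf {l : ℝ≥0∞ | 0 < l ∧ l < ∞ ∧ seqLebModular p q μ (fun k x => g k x / l) ≤ 1}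

/-- The quasi-norm of `L^{p(·)}(X, μ)` on extended real valued functions. -/
noncomputable def lpNorm (p : X → ℝ) (μ : Measure X) (u : X → EReal) : ℝ≥0∞ :=
  lebNorm p μ (fun x => (u x).abs)

/-- The space `L^{p(·)}(X, μ)`: measurable functions with finite modular. -/
def lpSpace (p : X → ℝ) (μ : Measure X) : Set (X → EReal) :=
  {u | Measurable u ∧ modular p μ (fun x => (u x).abs) < ∞}

end Lebesgue

/-! ### Hajłasz-Triebel-Lizorkin and Hajłasz-Besov spaces -/

section Hajlasz

variable {X : Type*} [MetricSpace X] [MeasurableSpace X]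

/-- The collection `𝔻^{s(·)}(u)` of vector `s(·)`-gradients of `u`. -/
def vectorGradients (s : X → ℝ) (μ : Measure X) (u : X → EReal) : Set (ℤ → X → ℝ≥0∞) :=
  {g | (∀ k, Measurable (g k)) ∧ ∃ N : Set X, μ N = 0 ∧
    ∀ (k : ℤ) (x y : X), x ∉ N → y ∉ N →
      (2 : ℝ) ^ (-k - 1) ≤ dist x y → dist x y < (2 : ℝ) ^ (-k) →
      (u x - u y).abs ≤
        ENNReal.ofReal (dist x y ^ s x) * g k x + ENNReal.ofReal (dist x y ^ s y) * g k y}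

/-- The homogeneous Hajłasz-Triebel-Lizorkin quasi-seminorm. -/
noncomputable def homTLNorm (s p : X → ℝ) (q : X → ℝ≥0∞) (μ : Measure X) (u : X → EReal) :
    ℝ≥0∞ :=
  ⨅ g ∈ vectorGradients s μ u, lebSeqNorm p q μ g

/-- The homogeneous Hajłasz-Besov quasi-seminorm. -/
noncomputable def homBesovNorm (s p : X → ℝ) (q : X → ℝ≥0∞) (μ : Measure X) (u : X → EReal) :
    ℝ≥0∞ :=
  ⨅ g ∈ vectorGradients s μ u, seqLebNorm p q μ g

/-- The homogeneous Hajłasz-Triebel-Lizorkin space. -/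
def homTLSpace (s p : X → ℝ) (q : X → ℝ≥0∞) (μ : Measure X) : Set (X → EReal) :=
  {u | Measurable u ∧ (∀ᵐ x ∂μ, u x ≠ ⊥ ∧ u x ≠ ⊤) ∧ homTLNorm s p q μ u < ∞}

/-- The homogeneous Hajłasz-Besov space. -/
def homBesovSpace (s p : X → ℝ) (q : X → ℝ≥0∞) (μ : Measure X) : Set (X → EReal) :=
  {u | Measurable u ∧ (∀ᵐ x ∂μ, u x ≠ ⊥ ∧ u x ≠ ⊤) ∧ homBesovNorm s p q μ u < ∞}

/-- The Hajłasz-Triebel-Lizorkin space `M^{s(·)}_{p(·),q(·)}(X, d, μ)`. -/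
def TLSpace (s p : X → ℝ) (q : X → ℝ≥0∞) (μ : Measure X) : Set (X → EReal) :=
  homTLSpace s p q μ ∩ lpSpace p μ

/-- The Hajłasz-Besov space `N^{s(·)}_{p(·),q(·)}(X, d, μ)`. -/
def BesovSpace (s p : X → ℝ) (q : X → ℝ≥0∞) (μ : Measure X) : Set (X → EReal) :=
  homBesovSpace s p q μ ∩ lpSpace p μ

/-- The quasi-norm of `M^{s(·)}_{p(·),q(·)}(X, d, μ)`. -/
noncomputable def tlNorm (s p : X → ℝ) (q : X → ℝ≥0∞) (μ : Measure X) (u : X → EReal) : ℝ≥0∞ :=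
  lpNorm p μ u + homTLNorm s p q μ u

/-- The quasi-norm of `N^{s(·)}_{p(·),q(·)}(X, d, μ)`. -/
noncomputable def besovNorm (s p : X → ℝ) (q : X → ℝ≥0∞) (μ : Measure X) (u : X → EReal) :
    ℝ≥0∞ :=
  lpNorm p μ u + homBesovNorm s p q μ u

end Hajlasz

/-- Continuous embedding `E ↪ F` of quasi-normed function spaces: `E ⊆ F`, and the inclusion is
bounded. -/
def ContinuouslyEmbeds {X : Type*} (E : Set (X → EReal)) (normE : (X → EReal) → ℝ≥0∞)
    (F : Set (X → EReal)) (normF : (X → EReal) → ℝ≥0∞) : Prop :=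
  E ⊆ F ∧ ∃ C : ℝ≥0∞, C < ∞ ∧ ∀ u ∈ E, normF u ≤ C * normE u

end VarHajlasz

/-!
Put `F = |u| ^ p + g ^ p` and `θ(z) = 1 / γ(z) = 1 / p(z) - s(z) / Q(z)`. By lower Ahlfors
regularity the ball `B(x, 2 ^ (-j / Q(x)))` has measure at least a multiple of `2 ^ (-j)`, so by
Chebyshev's inequality it meets `{F ≤ c 2 ^ j}` when `∫ F` is bounded. Along a chain that descends
from `z` through such points, a Hajłasz gradient pays at most a multiple of `2 ^ (j θ(z))` for the
`j`-th link: log-Hölder continuity freezes the exponents at `z`. Starting at the level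
`2 ^ n ≈ 1 + g(z) ^ p(z)` and summing the geometric series gives the pointwise bound
`|u| ^ γ ≲ |u| ^ p + g ^ p`, which is then integrated.

Only distances less than `1` occur, so a sequence of gradients may be replaced by the single
gradient `sup_{k ≥ 0} g_k`, which is controlled in `M` for every `q` and in `N` when `q ≤ p`. In `N`
with `t ≪ s`, the gradient `sup_{k ≥ 0} 2 ^ (-ε k) g_k` of smoothness `t` is controlled for every
`q`.
-/

namespace VarHajlasz

section ScalarExponents

/-- The Sobolev exponent `Q p / (Q - s p)` of smoothness `s` and integrability `p` in dimension
`Q`, for the values of the variable exponents at a single point. -/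
noncomputable def sobolevExponent (Q p s : ℝ) : ℝ :=
  Q * p / (Q - s * p)

/-- Quantitative subcriticality `s p < Q` of the values of the exponents at a point: all chaining
constants depend on the values only through the lower bound `a` (for `p` and for the gap
`Q - s p`) and the upper bound `M`. -/
structure UniformlySubcritical (a M Q p s : ℝ) : Prop where
  pos : 0 < a
  le_p : a ≤ p
  p_le : p ≤ M
  s_pos : 0 < s
  s_le : s ≤ M
  Q_le : Q ≤ M
  le_gap : a ≤ Q - s * p

namespace UniformlySubcritical

variable {a M Q p s : ℝ}

theorem p_pos (h : UniformlySubcritical a M Q p s) : 0 < p :=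
  h.pos.trans_le h.le_p

theorem le_Q (h : UniformlySubcritical a M Q p s) : a ≤ Q := by
  linarith [h.le_gap, mul_pos h.s_pos h.p_pos]

theorem Q_pos (h : UniformlySubcritical a M Q p s) : 0 < Q :=
  h.pos.trans_le h.le_Q

theorem M_pos (h : UniformlySubcritical a M Q p s) : 0 < M :=
  h.Q_pos.trans_le h.Q_le

theorem one_div_sobolevExponent (h : UniformlySubcritical a M Q p s) :
    1 / sobolevExponent Q p s = 1 / p - s / Q := by
  have hp := h.p_pos.ne'
  have hQ := h.Q_pos.ne'
  rw [sobolevExponent, one_div_div]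
  field_simp

theorem le_sobolevExponent (h : UniformlySubcritical a M Q p s) :
    p ≤ sobolevExponent Q p s := by
  rw [sobolevExponent, le_div_iff₀ (h.pos.trans_le h.le_gap), mul_comm Q]
  have := mul_pos h.s_pos h.p_pos
  exact mul_le_mul_of_nonneg_left (by linarith) h.p_pos.le

theorem sobolevExponent_pos (h : UniformlySubcritical a M Q p s) : 0 < sobolevExponent Q p s :=
  h.p_pos.trans_le h.le_sobolevExponent

theorem sobolevExponent_le (h : UniformlySubcritical a M Q p s) :
    sobolevExponent Q p s ≤ M * M / a := by
  have ha := h.pos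
  have hp := h.p_pos.le
  have hM := h.M_pos
  rw [sobolevExponent]
  exact div_le_div₀ (by positivity) (mul_le_mul h.Q_le h.p_le hp hM.le) ha h.le_gap

theorem le_one_div_sobolevExponent (h : UniformlySubcritical a M Q p s) :
    a / (M * M) ≤ 1 / sobolevExponent Q p s := by
  rw [← one_div_div]
  exact one_div_le_one_div_of_le h.sobolevExponent_pos h.sobolevExponent_le

end UniformlySubcritical

theorem le_rpow_one_div {g p c : ℝ} (hg : 0 ≤ g) (hp : 0 < p) (h : g ^ p ≤ c) :
    g ≤ c ^ (1 / p) := by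
  rwa [one_div, Real.le_rpow_inv_iff_of_pos hg ((Real.rpow_nonneg hg p).trans h) hp]

theorem rpow_mul_le_of_rpow_le {Q p s d g c : ℝ} {j : ℕ} (hp : 0 < p) (hs : 0 ≤ s) (hc : 0 ≤ c)
    (hd₀ : 0 ≤ d) (hd : d ≤ 2 ^ (-(j / Q))) (hg₀ : 0 ≤ g) (hg : g ^ p ≤ c * 2 ^ j) :
    d ^ s * g ≤ c ^ (1 / p) * (2 : ℝ) ^ (j * (1 / p - s / Q)) := by
  have hds : d ^ s ≤ (2 : ℝ) ^ (-(j / Q * s)) := by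
    rw [← neg_mul, Real.rpow_mul zero_le_two]
    exact Real.rpow_le_rpow hd₀ hd hs
  have hgp : g ≤ c ^ (1 / p) * (2 : ℝ) ^ (j * (1 / p)) := by
    rw [Real.rpow_mul zero_le_two, Real.rpow_natCast, ← Real.mul_rpow hc (by positivity)]
    exact le_rpow_one_div hg₀ hp hg
  calc d ^ s * g ≤ (2 : ℝ) ^ (-(j / Q * s)) * (c ^ (1 / p) * (2 : ℝ) ^ (j * (1 / p))) := by gcongr
    _ = c ^ (1 / p) * (2 : ℝ) ^ (-(j / Q * s) + j * (1 / p)) := by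
      rw [Real.rpow_add zero_lt_two]; ring
    _ = c ^ (1 / p) * (2 : ℝ) ^ (j * (1 / p - s / Q)) := by ring_nf

theorem rpow_le_two_mul_mul_rpow_add {U t p γ B : ℝ} (hU : 0 ≤ U) (ht : 0 ≤ t) (hp : 0 < p)
    (hpγ : p ≤ γ) (hB : 1 ≤ B) (h : U ^ γ ≤ B * (1 + t)) : U ^ γ ≤ 2 * B * (U ^ p + t) := by
  have hUp : 0 ≤ U ^ p := Real.rpow_nonneg hU p
  rcases le_total U 1 with hU₁ | hU₁
  · calc U ^ γ ≤ U ^ p := Real.rpow_le_rpow_of_exponent_ge_of_imp hU hU₁ hpγ (by intros; linarith)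
      _ ≤ 2 * B * (U ^ p + t) := by nlinarith
  · have hUp₁ : 1 ≤ U ^ p := Real.one_le_rpow hU₁ hp.le
    calc U ^ γ ≤ B * (1 + t) := h
      _ ≤ B * (2 * (U ^ p + t)) := by gcongr; linarith
      _ = 2 * B * (U ^ p + t) := by ring

end ScalarExponents

section LogHolder

variable {X : Type*} [MetricSpace X]

theorem LogHolder.exists_mul_abs_sub_le {f : X → ℝ} (hf : LogHolder f) {ρ D : ℝ} (hρ₀ : 0 < ρ)
    (hρ₁ : ρ < 1) (hD : 1 ≤ D) :
    ∃ L : ℝ, 0 ≤ L ∧ ∀ (j : ℕ) (x y : X), dist x y ≤ D * ρ ^ j → j * |f x - f y| ≤ L := by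
  obtain ⟨C, hC, hf⟩ := hf
  have hρ : 0 < -Real.log ρ := neg_pos.2 (Real.log_neg hρ₀ hρ₁)
  have hlogD : 0 ≤ Real.log D := Real.log_nonneg hD
  refine ⟨C * ((1 + Real.log D) / -Real.log ρ), by positivity, fun j x y hxy => ?_⟩
  rcases eq_or_ne x y with rfl | hne
  · rw [sub_self, abs_zero, mul_zero]; positivity
  have hd : 0 < dist x y := dist_pos.2 hne
  have hd' : 0 < 1 / dist x y := one_div_pos.2 hd
  have he := Real.exp_pos 1
  set t := Real.log (Real.exp 1 + 1 / dist x y)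
  have ht₁ : 1 ≤ t := (Real.le_log_iff_exp_le (by positivity)).2 (by linarith)
  have ht : -Real.log (dist x y) ≤ t := by
    rw [← Real.log_inv, ← one_div]
    exact Real.log_le_log hd' (by linarith)
  have hlog : Real.log (dist x y) ≤ Real.log D + j * Real.log ρ := by
    rw [← Real.log_pow, ← Real.log_mul (by positivity) (by positivity)]
    exact Real.log_le_log hd hxy
  have hj : (j : ℝ) ≤ t * ((1 + Real.log D) / -Real.log ρ) := by
    rw [← mul_div_assoc, le_div_iff₀ hρ]
    nlinarith
  have : 0 < t := by linarith
  calc (j : ℝ) * |f x - f y| ≤ t * ((1 + Real.log D) / -Real.log ρ) * (C / t) := by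
        gcongr; exact hf x y
    _ = C * ((1 + Real.log D) / -Real.log ρ) := by field_simp

theorem exists_mul_le_add_mul_one_div_sobolevExponent {Q p s : X → ℝ}
    (hQ : LogHolder fun x => 1 / Q x) (hp : LogHolder fun x => 1 / p x)
    (hs : LogHolder fun x => 1 / s x) {a M ρ D : ℝ} (ha : 0 < a) (hM : 0 < M) (hρ₀ : 0 < ρ)
    (hρ₁ : ρ < 1) (hD : 1 ≤ D) :
    ∃ L : ℝ, ∀ (j : ℕ) (x y z : X), UniformlySubcritical a M (Q x) (p x) (s x) →
      UniformlySubcritical a M (Q z) (p z) (s z) → dist x z ≤ D * ρ ^ j → dist y z ≤ D * ρ ^ j →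
      j * (1 / p x - s x / Q y) ≤ L + j * (1 / sobolevExponent (Q z) (p z) (s z)) := by
  obtain ⟨LQ, _, hQ⟩ := hQ.exists_mul_abs_sub_le hρ₀ hρ₁ hD
  obtain ⟨Lp, -, hp⟩ := hp.exists_mul_abs_sub_le hρ₀ hρ₁ hD
  obtain ⟨Ls, _, hs⟩ := hs.exists_mul_abs_sub_le hρ₀ hρ₁ hD
  refine ⟨Lp + M * LQ + M * M / a * Ls, fun j x y z hx hz hxz hyz => ?_⟩
  have hsx := hx.s_pos
  have hsz := hz.s_pos
  have hQz := hz.Q_pos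
  have hp_osc : j * (1 / p x - 1 / p z) ≤ Lp :=
    (mul_le_mul_of_nonneg_left (le_abs_self _) j.cast_nonneg).trans (hp j x z hxz)
  have hQ_osc : s x * (j * (1 / Q z - 1 / Q y)) ≤ M * LQ := by
    refine mul_le_mul hx.s_le ?_ (by positivity) hM.le |>.trans' (mul_le_mul_of_nonneg_left
      (mul_le_mul_of_nonneg_left (le_abs_self _) j.cast_nonneg) hsx.le)
    rw [abs_sub_comm]
    exact hQ j y z hyz
  have hs_osc : s z * s x / Q z * (j * (1 / s x - 1 / s z)) ≤ M * M / a * Ls := by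
    refine mul_le_mul ?_ ?_ (by positivity) (by positivity) |>.trans' (mul_le_mul_of_nonneg_left
      (mul_le_mul_of_nonneg_left (le_abs_self _) j.cast_nonneg) (by positivity))
    · exact div_le_div₀ (by positivity) (mul_le_mul hz.s_le hx.s_le hsx.le hM.le) ha hz.le_Q
    · exact hs j x z hxz
  have hsplit : j * (1 / p x - s x / Q y) = j * (1 / p x - 1 / p z)
      + s x * (j * (1 / Q z - 1 / Q y)) + s z * s x / Q z * (j * (1 / s x - 1 / s z))
      + j * (1 / p z - s z / Q z) := by
    field_simp
    ring
  rw [hsplit, hz.one_div_sobolevExponent]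
  linarith

end LogHolder

section Chaining

theorem dist_le_div_mul_pow_of_geometric {α : Type*} [PseudoMetricSpace α] {f : ℕ → α} {C r : ℝ}
    {n : ℕ} (hr : 1 < r) (hC : 0 ≤ C) (hf : ∀ j < n, dist (f j) (f (j + 1)) ≤ C * r ^ j) :
    dist (f 0) (f n) ≤ C / (r - 1) * r ^ n := by
  have : 0 < r - 1 := sub_pos.2 hr
  calc dist (f 0) (f n) ≤ ∑ j ∈ Finset.range n, C * r ^ j :=
        dist_le_range_sum_of_dist_le n fun {j} hj => hf j hj
    _ = C / (r - 1) * (r ^ n - 1) := by rw [← Finset.mul_sum, geom_sum_eq hr.ne']; ring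
    _ ≤ C / (r - 1) * r ^ n := by gcongr; linarith

variable {X : Type*} [MetricSpace X]

/-- A chain `w` in `T` that starts at a low-level point `w 0` and reaches `z` after `n` steps: the
link from `w (j + 1)` to `w j` has length less than `2 ^ (-j / Q)`, the radius at which lower
Ahlfors regularity guarantees measure about `2 ^ (-j)`, and it ends where `F ≤ c 2 ^ j`. The chain
is continued by the constant `z`, so that it is a convergent sequence. -/
structure IsDescent (Q F : X → ℝ) (c : ℝ) (T : Set X) (n : ℕ) (z : X) (w : ℕ → X) : Prop where
  mem : ∀ j, w j ∈ T
  eq_of_le : ∀ j, n ≤ j → w j = z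
  dist_lt : ∀ j : ℕ, dist (w (j + 1)) (w j) < 2 ^ (-(j / Q (w (j + 1))))
  le_of_lt : ∀ j < n, F (w j) ≤ c * 2 ^ j

variable {Q F : X → ℝ} {c : ℝ} {T : Set X}

theorem exists_isDescent
    (hT : ∀ x ∈ T, ∀ j : ℕ, ∃ y ∈ T, dist x y < 2 ^ (-(j / Q x)) ∧ F y ≤ c * 2 ^ j) (n : ℕ)
    {z : X} (hz : z ∈ T) : ∃ w, IsDescent Q F c T n z w := by
  induction n generalizing z with
  | zero =>
    exact ⟨fun _ => z, fun _ => hz, fun _ _ => rfl, fun j => by rw [dist_self]; positivity,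
      fun j hj => absurd hj j.not_lt_zero⟩
  | succ n ih =>
    obtain ⟨y, hy, hzy, hFy⟩ := hT z hz n
    obtain ⟨w, hw⟩ := ih hy
    refine ⟨fun j => if j ≤ n then w j else z, fun j => ?_, fun j hj => if_neg (by lia),
      fun j => ?_, fun j hj => ?_⟩
    · split_ifs
      exacts [hw.mem j, hz]
    · rcases lt_trichotomy j n with hj | rfl | hj
      · simpa only [if_pos (Nat.succ_le_of_lt hj), if_pos hj.le] using hw.dist_lt j
      · simpa only [j.not_succ_le_self, if_false, le_refl, if_true, hw.eq_of_le j le_rfl] using hzy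
      · rw [if_neg (by lia), if_neg (by lia), dist_self]
        positivity
    · rw [if_pos (Nat.le_of_lt_succ hj)]
      rcases (Nat.le_of_lt_succ hj).lt_or_eq with hj | rfl
      · exact hw.le_of_lt j hj
      · rwa [hw.eq_of_le j le_rfl]

theorem IsDescent.dist_le {n : ℕ} {z : X} {w : ℕ → X} (hw : IsDescent Q F c T n z w) {M : ℝ}
    (hM : 0 < M) (hQ₀ : ∀ x ∈ T, 0 < Q x) (hQ : ∀ x ∈ T, Q x ≤ M) (j : ℕ) :
    dist (w j) z ≤ 1 / (1 - (2 : ℝ) ^ (-(1 / M))) * ((2 : ℝ) ^ (-(1 / M))) ^ j := by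
  have hρ : (2 : ℝ) ^ (-(1 / M)) < 1 :=
    Real.rpow_lt_one_of_one_lt_of_neg one_lt_two (neg_lt_zero.2 (one_div_pos.2 hM))
  have hstep (i : ℕ) : dist (w i) (w (i + 1)) ≤ 1 * ((2 : ℝ) ^ (-(1 / M))) ^ i := by
    rw [dist_comm, one_mul, ← Real.rpow_mul_natCast zero_le_two]
    refine (hw.dist_lt i).le.trans (Real.rpow_le_rpow_of_exponent_le one_le_two ?_)
    rw [neg_mul, neg_le_neg_iff, one_div_mul_eq_div]
    exact div_le_div_of_nonneg_left i.cast_nonneg (hQ₀ _ (hw.mem _)) (hQ _ (hw.mem _))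
  have hlim : Tendsto w atTop (nhds z) :=
    tendsto_const_nhds.congr' ((eventually_ge_atTop n).mono fun i hi => (hw.eq_of_le i hi).symm)
  exact (dist_le_of_le_geometric_of_tendsto _ _ hρ hstep hlim j).trans_eq (by ring)

/-- The input of the chaining argument for a function `U` with gradient `G`: uniformly subcritical
exponents, the Hajłasz inequality at distances below `1`, and the fact that every ball
`B(x, 2 ^ (-j / Q))` meets the sublevel set `|U| ^ p + G ^ p ≤ c 2 ^ j`. -/
structure IsChainable (Q p s : X → ℝ) (a M c : ℝ) (T : Set X) (U G : X → ℝ) : Prop where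
  subcritical : ∀ x ∈ T, UniformlySubcritical a M (Q x) (p x) (s x)
  gradient_nonneg : ∀ x, 0 ≤ G x
  abs_sub_le : ∀ x ∈ T, ∀ y ∈ T, dist x y < 1 →
    |U x - U y| ≤ dist x y ^ s x * G x + dist x y ^ s y * G y
  exists_near : ∀ x ∈ T, ∀ j : ℕ, ∃ y ∈ T, dist x y < 2 ^ (-(j / Q x)) ∧
    |U y| ^ p y + G y ^ p y ≤ c * 2 ^ j

variable {p s : X → ℝ} {a M : ℝ}

theorem IsDescent.gradient_rpow_le {U G : X → ℝ} {n : ℕ} {z : X} {w : ℕ → X} (hc : 1 ≤ c)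
    (hw : IsDescent Q (fun x => |U x| ^ p x + G x ^ p x) c T n z w) (hz : G z ^ p z ≤ 2 ^ n)
    {j : ℕ} (hj : j ≤ n) : G (w j) ^ p (w j) ≤ c * 2 ^ j := by
  rcases hj.lt_or_eq with hj | rfl
  · exact (le_add_of_nonneg_left (Real.rpow_nonneg (abs_nonneg _) _)).trans (hw.le_of_lt j hj)
  · rw [hw.eq_of_le j le_rfl]
    exact hz.trans (le_mul_of_one_le_left (by positivity) hc)

/-- By log-Hölder continuity the exponents at points `x`, `y` of the chain may be replaced by those
at its end point `z`. -/
theorem exists_rpow_mul_le_of_rpow_le (hQ : LogHolder fun x => 1 / Q x)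
    (hp : LogHolder fun x => 1 / p x) (hs : LogHolder fun x => 1 / s x) {ρ D : ℝ} (ha : 0 < a)
    (hM : 0 < M) (hρ₀ : 0 < ρ) (hρ₁ : ρ < 1) (hD : 1 ≤ D) (hc : 1 ≤ c) :
    ∃ C : ℝ, 0 ≤ C ∧ ∀ (j : ℕ) (x y z : X) (d g : ℝ),
      UniformlySubcritical a M (Q x) (p x) (s x) → UniformlySubcritical a M (Q z) (p z) (s z) →
      dist x z ≤ D * ρ ^ j → dist y z ≤ D * ρ ^ j →
      0 ≤ d → d ≤ 2 ^ (-(j / Q y)) → 0 ≤ g → g ^ p x ≤ c * 2 ^ j →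
      d ^ s x * g ≤ C * ((2 : ℝ) ^ (1 / sobolevExponent (Q z) (p z) (s z))) ^ j := by
  obtain ⟨L, hL⟩ := exists_mul_le_add_mul_one_div_sobolevExponent hQ hp hs ha hM hρ₀ hρ₁ hD
  refine ⟨c ^ (1 / a) * 2 ^ L, by positivity, ?_⟩
  intro j x y z d g hx hz hxz hyz hd₀ hd hg₀ hg
  calc d ^ s x * g ≤ c ^ (1 / p x) * (2 : ℝ) ^ (j * (1 / p x - s x / Q y)) :=
        rpow_mul_le_of_rpow_le hx.p_pos hx.s_pos.le (by positivity) hd₀ hd hg₀ hg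
    _ ≤ c ^ (1 / a) * (2 : ℝ) ^ (L + j * (1 / sobolevExponent (Q z) (p z) (s z))) := by
        gcongr
        · exact hx.le_p
        · exact one_le_two
        · exact hL j x y z hx hz hxz hyz
    _ = _ := by
        rw [Real.rpow_add two_pos, mul_comm (j : ℝ), Real.rpow_mul_natCast two_pos.le, mul_assoc]

theorem exists_isDescent_increment_le (hQ : LogHolder fun x => 1 / Q x)
    (hp : LogHolder fun x => 1 / p x) (hs : LogHolder fun x => 1 / s x) (ha : 0 < a) (hM : 0 < M)
    (hc : 1 ≤ c) :
    ∃ C : ℝ, 0 ≤ C ∧ ∀ (T : Set X) (U G : X → ℝ), IsChainable Q p s a M c T U G →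
      ∀ (n : ℕ) (z : X) (w : ℕ → X), z ∈ T → G z ^ p z ≤ 2 ^ n →
        IsDescent Q (fun x => |U x| ^ p x + G x ^ p x) c T n z w →
        ∀ j < n, |U (w j) - U (w (j + 1))| ≤
          C * ((2 : ℝ) ^ (1 / sobolevExponent (Q z) (p z) (s z))) ^ j := by
  set ρ : ℝ := 2 ^ (-(1 / M))
  have hρ₀ : 0 < ρ := by positivity
  have hρ₁ : ρ < 1 :=
    Real.rpow_lt_one_of_one_lt_of_neg one_lt_two (neg_lt_zero.2 (one_div_pos.2 hM))
  have hD : 1 ≤ 1 / (1 - ρ) := (one_le_div (by linarith)).2 (by linarith)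
  obtain ⟨C, hC, hlink⟩ := exists_rpow_mul_le_of_rpow_le hQ hp hs ha hM hρ₀ hρ₁ hD
    (c := 2 * c) (by linarith)
  refine ⟨2 * C, by positivity, fun T U G h n z w hz hGz hw j hj => ?_⟩
  have hdist (i : ℕ) : dist (w i) z ≤ 1 / (1 - ρ) * ρ ^ i :=
    hw.dist_le hM (fun x hx => (h.subcritical x hx).Q_pos) (fun x hx => (h.subcritical x hx).Q_le) i
  have hdist_succ : dist (w (j + 1)) z ≤ 1 / (1 - ρ) * ρ ^ j :=
    (hdist (j + 1)).trans (mul_le_mul_of_nonneg_left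
      (pow_le_pow_of_le_one hρ₀.le hρ₁.le j.le_succ) (by positivity))
  have hG : G (w j) ^ p (w j) ≤ 2 * c * 2 ^ j :=
    (hw.gradient_rpow_le hc hGz hj.le).trans (by gcongr; linarith)
  have hG_succ : G (w (j + 1)) ^ p (w (j + 1)) ≤ 2 * c * 2 ^ j :=
    (hw.gradient_rpow_le hc hGz hj).trans_eq (by rw [pow_succ]; ring)
  have hd := hw.dist_lt j
  have hd₁ : dist (w (j + 1)) (w j) < 1 :=
    hd.trans_le (Real.rpow_le_one_of_one_le_of_nonpos one_le_two
      (neg_nonpos.2 (div_nonneg j.cast_nonneg (h.subcritical _ (hw.mem _)).Q_pos.le)))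
  have hterm {x : X} (hx : x ∈ T) (hxz : dist x z ≤ 1 / (1 - ρ) * ρ ^ j)
      (hGx : G x ^ p x ≤ 2 * c * 2 ^ j) := hlink j x (w (j + 1)) z _ (G x) (h.subcritical x hx)
    (h.subcritical z hz) hxz hdist_succ dist_nonneg hd.le (h.gradient_nonneg x) hGx
  rw [abs_sub_comm, mul_assoc, two_mul]
  exact (h.abs_sub_le _ (hw.mem _) _ (hw.mem _) hd₁).trans
    (add_le_add (hterm (hw.mem _) hdist_succ hG_succ) (hterm (hw.mem _) (hdist j) hG))

theorem IsChainable.abs_le_of_isDescent {U G : X → ℝ} {n : ℕ} {z : X} {w : ℕ → X}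
    (h : IsChainable Q p s a M c T U G) (hc : 1 ≤ c) (hn : 0 < n)
    (hw : IsDescent Q (fun x => |U x| ^ p x + G x ^ p x) c T n z w) :
    |U (w 0)| ≤ c ^ (1 / a) := by
  have hw₀ := h.subcritical _ (hw.mem 0)
  have ha := hw₀.pos
  have hUp : |U (w 0)| ^ p (w 0) ≤ c := by
    have := hw.le_of_lt 0 hn
    have := Real.rpow_nonneg (h.gradient_nonneg (w 0)) (p (w 0))
    linarith
  refine (le_rpow_one_div (abs_nonneg _) hw₀.p_pos hUp).trans ?_
  gcongr
  exact hw₀.le_p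

theorem exists_abs_le_mul_rpow_one_div_sobolevExponent (hQ : LogHolder fun x => 1 / Q x)
    (hp : LogHolder fun x => 1 / p x) (hs : LogHolder fun x => 1 / s x) (ha : 0 < a) (hM : 0 < M)
    (hc : 1 ≤ c) :
    ∃ K : ℝ, 1 ≤ K ∧ ∀ (T : Set X) (U G : X → ℝ), IsChainable Q p s a M c T U G → ∀ z ∈ T,
      |U z| ≤ K * (2 * (1 + G z ^ p z)) ^ (1 / sobolevExponent (Q z) (p z) (s z)) := by
  obtain ⟨C, hC, hinc⟩ := exists_isDescent_increment_le hQ hp hs ha hM hc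
  have hr₀ : 1 < (2 : ℝ) ^ (a / (M * M)) := Real.one_lt_rpow one_lt_two (by positivity)
  have hca : 1 ≤ c ^ (1 / a) := Real.one_le_rpow hc (by positivity)
  have hCr : 0 ≤ C / ((2 : ℝ) ^ (a / (M * M)) - 1) := div_nonneg hC (by linarith)
  refine ⟨C / (2 ^ (a / (M * M)) - 1) + c ^ (1 / a), by linarith, fun T U G h z hz => ?_⟩
  have hz' := h.subcritical z hz
  set t := G z ^ p z
  have ht : 0 ≤ t := Real.rpow_nonneg (h.gradient_nonneg z) _
  set θ := 1 / sobolevExponent (Q z) (p z) (s z)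
  have hθ : 0 < θ := one_div_pos.2 hz'.sobolevExponent_pos
  set r : ℝ := 2 ^ θ
  have hr : 2 ^ (a / (M * M)) ≤ r :=
    Real.rpow_le_rpow_of_exponent_le one_le_two hz'.le_one_div_sobolevExponent
  obtain ⟨n, hn, htn⟩ := exists_nat_pow_near (x := 1 + t) (by linarith) one_lt_two
  have hrn : r ^ (n + 1) ≤ (2 * (1 + t)) ^ θ := by
    rw [Real.rpow_pow_comm zero_le_two, pow_succ']
    gcongr
  obtain ⟨w, hw⟩ := exists_isDescent h.exists_near (n + 1) hz
  have hstart : |U (w 0)| ≤ c ^ (1 / a) := h.abs_le_of_isDescent hc n.succ_pos hw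
  have htele : dist (U (w 0)) (U (w (n + 1))) ≤ C / (r - 1) * r ^ (n + 1) :=
    dist_le_div_mul_pow_of_geometric (f := fun j => U (w j)) (hr₀.trans_le hr) hC
      (hinc T U G h _ z w hz (by linarith) hw)
  rw [hw.eq_of_le _ le_rfl, Real.dist_eq] at htele
  calc |U z| ≤ |U (w 0) - U z| + |U (w 0)| := by
        linarith [abs_sub_abs_le_abs_sub (U z) (U (w 0)), abs_sub_comm (U z) (U (w 0))]
    _ ≤ C / (2 ^ (a / (M * M)) - 1) * (2 * (1 + t)) ^ θ + c ^ (1 / a) * (2 * (1 + t)) ^ θ := by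
        refine add_le_add (htele.trans ?_) (hstart.trans (le_mul_of_one_le_right (by positivity)
          (Real.one_le_rpow (by linarith) hθ.le)))
        gcongr
    _ = _ := by ring

theorem exists_rpow_sobolevExponent_le (hQ : LogHolder fun x => 1 / Q x)
    (hp : LogHolder fun x => 1 / p x) (hs : LogHolder fun x => 1 / s x) (ha : 0 < a) (hM : 0 < M)
    (hc : 1 ≤ c) :
    ∃ K : ℝ, 0 ≤ K ∧ ∀ (T : Set X) (U G : X → ℝ), IsChainable Q p s a M c T U G → ∀ z ∈ T,
      |U z| ^ sobolevExponent (Q z) (p z) (s z) ≤ K * (|U z| ^ p z + G z ^ p z) := by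
  obtain ⟨K, hK, hbound⟩ := exists_abs_le_mul_rpow_one_div_sobolevExponent hQ hp hs ha hM hc
  have hK' : 1 ≤ K ^ (M * M / a) := Real.one_le_rpow hK (by positivity)
  refine ⟨2 * (2 * K ^ (M * M / a)), by positivity, fun T U G h z hz => ?_⟩
  have hz' := h.subcritical z hz
  set γ := sobolevExponent (Q z) (p z) (s z)
  have ht : 0 ≤ G z ^ p z := Real.rpow_nonneg (h.gradient_nonneg z) _
  refine rpow_le_two_mul_mul_rpow_add (abs_nonneg _) ht hz'.p_pos hz'.le_sobolevExponent
    (by linarith) ?_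
  calc |U z| ^ γ ≤ (K * (2 * (1 + G z ^ p z)) ^ (1 / γ)) ^ γ :=
        Real.rpow_le_rpow (abs_nonneg _) (hbound T U G h z hz) hz'.sobolevExponent_pos.le
    _ = K ^ γ * (2 * (1 + G z ^ p z)) := by
        rw [Real.mul_rpow (by linarith) (by positivity), one_div,
          Real.rpow_inv_rpow (by positivity) hz'.sobolevExponent_pos.ne']
    _ ≤ K ^ (M * M / a) * (2 * (1 + G z ^ p z)) := by
        gcongr
        exact hz'.sobolevExponent_le
    _ = 2 * K ^ (M * M / a) * (1 + G z ^ p z) := by ring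

end Chaining

section Modular

variable {X : Type*} [MeasurableSpace X] {μ : Measure X} {p : X → ℝ} {f : X → ℝ≥0∞}

theorem modular_mono_ae {g : X → ℝ≥0∞} (hp : ∀ᵐ x ∂μ, 0 ≤ p x) (hfg : f ≤ᵐ[μ] g) :
    modular p μ f ≤ modular p μ g := by
  refine lintegral_mono_ae ?_
  filter_upwards [hp, hfg] with x hx hfgx using ENNReal.rpow_le_rpow hfgx hx

theorem modular_mul_le {w : X → ℝ≥0∞} {W : ℝ≥0∞} (hp : ∀ᵐ x ∂μ, 0 ≤ p x) (hW : W ≠ ∞)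
    (hw : ∀ᵐ x ∂μ, w x ^ p x ≤ W) :
    modular p μ (fun x => w x * f x) ≤ W * modular p μ f := by
  rw [modular, modular, ← lintegral_const_mul' _ _ hW]
  refine lintegral_mono_ae ?_
  filter_upwards [hp, hw] with x hpx hwx
  rw [ENNReal.mul_rpow_of_nonneg _ _ hpx]
  gcongr

theorem ae_lt_top_of_modular_lt_top (hp : Measurable p) (hp₀ : ∀ᵐ x ∂μ, 0 < p x)
    (hf : Measurable f) (h : modular p μ f < ∞) : ∀ᵐ x ∂μ, f x < ∞ := by
  filter_upwards [hp₀, ae_lt_top (hf.pow hp) h.ne] with x hpx hx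
  exact (ENNReal.rpow_lt_top_iff_of_pos hpx).1 hx

theorem modular_div_le_one_of_lebNorm_lt (hp : ∀ᵐ x ∂μ, 0 ≤ p x) {L : ℝ≥0∞}
    (h : lebNorm p μ f < L) : modular p μ (fun x => f x / L) ≤ 1 := by
  obtain ⟨l, ⟨-, -, hl⟩, hlL⟩ := sInf_lt_iff.1 h
  exact (modular_mono_ae hp (.of_forall fun x => ENNReal.div_le_div_left hlL.le _)).trans hl

theorem lebNorm_le_mul_of_modular_div_le {a : ℝ} {B L : ℝ≥0∞} (ha : 0 < a)
    (hp : ∀ᵐ x ∂μ, a ≤ p x) (hB : 1 ≤ B) (hB' : B ≠ ∞) (hL : L ≠ 0) (hL' : L ≠ ∞)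
    (h : modular p μ (fun x => f x / L) ≤ B) : lebNorm p μ f ≤ L * B ^ (1 / a) := by
  have hB₀ : B ≠ 0 := (one_pos.trans_le hB).ne'
  have hC : B ^ (1 / a) ≠ 0 := (ENNReal.rpow_pos (one_pos.trans_le hB) hB').ne'
  have hC' : B ^ (1 / a) ≠ ∞ := ENNReal.rpow_ne_top_of_nonneg (one_div_pos.2 ha).le hB'
  refine sInf_le ⟨pos_iff_ne_zero.2 (mul_ne_zero hL hC), (ENNReal.mul_ne_top hL' hC').lt_top, ?_⟩
  have hscale : ∀ᵐ x ∂μ, ((B ^ (1 / a))⁻¹) ^ p x ≤ B⁻¹ := by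
    filter_upwards [hp] with x hx
    rw [ENNReal.inv_rpow, ENNReal.inv_le_inv, ← ENNReal.rpow_mul]
    exact ENNReal.le_rpow_self_of_one_le hB (by rwa [one_div_mul_eq_div, one_le_div ha])
  calc modular p μ (fun x => f x / (L * B ^ (1 / a)))
      = modular p μ (fun x => (B ^ (1 / a))⁻¹ * (f x / L)) := by
        congr 1 with x
        rw [div_eq_mul_inv (f x), div_eq_mul_inv (f x), ENNReal.mul_inv (.inl hL) (.inl hL')]
        ring
    _ ≤ B⁻¹ * B := (modular_mul_le (hp.mono fun x hx => ha.le.trans hx)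
        (ENNReal.inv_ne_top.2 hB₀) hscale).trans (by gcongr)
    _ = 1 := ENNReal.inv_mul_cancel hB₀ hB'

theorem lebNorm_lt_top {a : ℝ} (ha : 0 < a) (hp : ∀ᵐ x ∂μ, a ≤ p x) (h : modular p μ f < ∞) :
    lebNorm p μ f < ∞ := by
  have hB : max 1 (modular p μ f) < ∞ := max_lt ENNReal.one_lt_top h
  refine (lebNorm_le_mul_of_modular_div_le ha hp (le_max_left 1 (modular p μ f)) hB.ne one_ne_zero
    ENNReal.one_ne_top (by simp only [div_one]; exact le_max_right _ _)).trans_lt ?_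
  rw [one_mul]
  exact ENNReal.rpow_lt_top_of_nonneg (one_div_pos.2 ha).le hB.ne

theorem modular_lt_top_of_modular_div_lt_top {Γ : ℝ} {L : ℝ≥0∞} (hp₀ : ∀ᵐ x ∂μ, 0 ≤ p x)
    (hp : ∀ᵐ x ∂μ, p x ≤ Γ) (hΓ : 0 ≤ Γ) (hL : L ≠ 0) (hL' : L ≠ ∞)
    (h : modular p μ (fun x => f x / L) < ∞) : modular p μ f < ∞ := by
  have hW : max 1 L ^ Γ ≠ ∞ :=
    ENNReal.rpow_ne_top_of_nonneg hΓ (max_lt ENNReal.one_lt_top hL'.lt_top).ne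
  have hscale : ∀ᵐ x ∂μ, L ^ p x ≤ max 1 L ^ Γ := by
    filter_upwards [hp₀, hp] with x hx₀ hx
    exact (ENNReal.rpow_le_rpow (le_max_right 1 L) hx₀).trans
      (ENNReal.rpow_le_rpow_of_exponent_le (le_max_left 1 L) hx)
  calc modular p μ f = modular p μ (fun x => L * (f x / L)) := by
        simp only [ENNReal.mul_div_cancel hL hL']
    _ ≤ max 1 L ^ Γ * modular p μ (fun x => f x / L) := modular_mul_le hp₀ hW hscale
    _ < ∞ := ENNReal.mul_lt_top hW.lt_top h

theorem continuouslyEmbeds_lpSpace_of_modular_div_le {γ : X → ℝ} {a Γ : ℝ} {B : ℝ≥0∞}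
    {E : Set (X → EReal)} {normE : (X → EReal) → ℝ≥0∞} (ha : 0 < a)
    (hγ : ∀ᵐ x ∂μ, a ≤ γ x) (hΓ : 0 ≤ Γ) (hγ' : ∀ᵐ x ∂μ, γ x ≤ Γ) (hB : B ≠ ∞)
    (hmeas : ∀ u ∈ E, Measurable u) (hfin : ∀ u ∈ E, normE u < ∞)
    (h : ∀ u ∈ E, ∀ L, normE u < L → L < ∞ → modular γ μ (fun x => (u x).abs / L) ≤ B) :
    ContinuouslyEmbeds E normE (lpSpace γ μ) (lpNorm γ μ) := by
  have hB' : max 1 B ≠ ∞ := (max_lt ENNReal.one_lt_top hB.lt_top).ne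
  have hC : max 1 B ^ (1 / a) ≠ ∞ := ENNReal.rpow_ne_top_of_nonneg (one_div_pos.2 ha).le hB'
  refine ⟨fun u hu => ⟨hmeas u hu, ?_⟩, _, hC.lt_top, fun u hu => ?_⟩
  · obtain ⟨L, hL, hL'⟩ := exists_between (hfin u hu)
    exact modular_lt_top_of_modular_div_lt_top (hγ.mono fun x hx => ha.le.trans hx) hγ' hΓ
      hL.bot_lt.ne' hL'.ne ((h u hu L hL hL').trans_lt hB.lt_top)
  · rw [mul_comm]
    refine ENNReal.le_mul_of_forall_lt (.inr hC) (.inl (hfin u hu).ne) fun L hL C hC' => ?_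
    rcases eq_or_ne L ∞ with rfl | hL'
    · rw [ENNReal.top_mul hC'.bot_lt.ne']
      exact le_top
    · exact (lebNorm_le_mul_of_modular_div_le ha hγ (le_max_left 1 B) hB' hL.bot_lt.ne' hL'
        ((h u hu L hL hL'.lt_top).trans (le_max_right 1 B))).trans (by gcongr)

theorem modular_iSup_le {ι : Type*} [Countable ι] (hp : Measurable p) (hp₀ : ∀ᵐ x ∂μ, 0 < p x)
    {h : ι → X → ℝ≥0∞} (hh : ∀ k, Measurable (h k)) :
    modular p μ (fun x => ⨆ k, h k x) ≤ ∑' k, modular p μ (h k) := by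
  simp only [modular]
  rw [← lintegral_tsum fun k => ((hh k).pow hp).aemeasurable]
  refine lintegral_mono_ae ?_
  filter_upwards [hp₀] with x hx
  rw [← ENNReal.le_rpow_inv_iff hx]
  exact iSup_le fun k => (ENNReal.le_rpow_inv_iff hx).2 (ENNReal.le_tsum k)

theorem modular_iSup_geometric_le {a : ℝ} (hp : Measurable p) (ha : 0 < a)
    (hpa : ∀ᵐ x ∂μ, a ≤ p x) {r W : ℝ≥0∞} (hr : r ≤ 1) {h : ℕ → X → ℝ≥0∞}
    (hh : ∀ k, Measurable (h k)) (hW : ∀ k, modular p μ (h k) ≤ W) :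
    modular p μ (fun x => ⨆ k, r ^ k * h k x) ≤ (1 - r ^ a)⁻¹ * W := by
  have hp₀ : ∀ᵐ x ∂μ, 0 < p x := hpa.mono fun _ => ha.trans_le
  refine (modular_iSup_le hp hp₀ fun k => (hh k).const_mul _).trans ?_
  rw [← ENNReal.tsum_geometric, ← ENNReal.tsum_mul_right]
  refine ENNReal.tsum_le_tsum fun k => ?_
  have hrk : r ^ k ≤ 1 := pow_le_one₀ zero_le hr
  have hweight : ∀ᵐ x ∂μ, (r ^ k) ^ p x ≤ (r ^ a) ^ k := by
    filter_upwards [hpa] with x hx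
    calc (r ^ k) ^ p x ≤ (r ^ k) ^ a := ENNReal.rpow_le_rpow_of_exponent_ge hrk hx
      _ = (r ^ a) ^ k := by
        rw [← ENNReal.rpow_natCast, ← ENNReal.rpow_natCast, ← ENNReal.rpow_mul, mul_comm,
          ENNReal.rpow_mul]
  have hW' : (r ^ a) ^ k ≠ ∞ := ENNReal.pow_ne_top
    (ENNReal.rpow_ne_top_of_nonneg ha.le (ne_top_of_le_ne_top ENNReal.one_ne_top hr))
  exact (modular_mul_le (hp₀.mono fun _ => le_of_lt) hW' hweight).trans (by gcongr; exact hW k)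

end Modular

section MixedNorms

variable {X : Type*}

theorem le_seqNorm {q : X → ℝ≥0∞} {x : X} (hq : 0 < q x) (g : ℤ → X → ℝ≥0∞) (k : ℤ) :
    g k x ≤ seqNorm q g x := by
  unfold seqNorm
  split_ifs with h
  · exact le_iSup (fun k => g k x) k
  · rw [one_div, ENNReal.le_rpow_inv_iff (ENNReal.toReal_pos hq.ne' h)]
    exact ENNReal.le_tsum (f := fun k => g k x ^ (q x).toReal) k

variable [MeasurableSpace X] {μ : Measure X} {p : X → ℝ} {q : X → ℝ≥0∞}

/-- The quantity written `‖ |f| ^ q ‖` in `L^{p(·)/q(·)}`, whose sum over the members of a sequence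
is `seqLebModular`. It is defined without the power `|f| ^ q`, so that `q = ∞` is allowed. -/
noncomputable def lebNormPow (p : X → ℝ) (q : X → ℝ≥0∞) (μ : Measure X) (f : X → ℝ≥0∞) : ℝ≥0∞ :=
  sInf {l : ℝ≥0∞ | 0 < l ∧ l < ∞ ∧ modular p μ (fun x => f x / l ^ ((q x)⁻¹).toReal) ≤ 1}

theorem seqLebModular_eq_tsum_lebNormPow (p : X → ℝ) (q : X → ℝ≥0∞) (μ : Measure X)
    (g : ℤ → X → ℝ≥0∞) : seqLebModular p q μ g = ∑' k, lebNormPow p q μ (g k) :=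
  rfl

theorem lebNormPow_mono {f g : X → ℝ≥0∞} (hp : ∀ᵐ x ∂μ, 0 ≤ p x) (hfg : ∀ x, f x ≤ g x) :
    lebNormPow p q μ f ≤ lebNormPow p q μ g :=
  sInf_le_sInf fun _ ⟨h₀, htop, hl⟩ => ⟨h₀, htop, (modular_mono_ae hp (.of_forall fun x =>
    ENNReal.div_le_div_right (hfg x) _)).trans hl⟩

theorem seqLebModular_div_le_one_of_seqLebNorm_lt (hp : ∀ᵐ x ∂μ, 0 ≤ p x) {g : ℤ → X → ℝ≥0∞}
    {L : ℝ≥0∞} (h : seqLebNorm p q μ g < L) :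
    seqLebModular p q μ (fun k x => g k x / L) ≤ 1 := by
  obtain ⟨l, ⟨-, -, hl⟩, hlL⟩ := sInf_lt_iff.1 h
  exact (ENNReal.tsum_le_tsum fun k => lebNormPow_mono hp fun x =>
    ENNReal.div_le_div_left hlL.le (g k x)).trans hl

theorem modular_le_of_lebNormPow_lt {f : X → ℝ≥0∞} {l W : ℝ≥0∞} (hp : ∀ᵐ x ∂μ, 0 ≤ p x)
    (h : lebNormPow p q μ f < l) (hW : W ≠ ∞)
    (hlW : ∀ᵐ x ∂μ, l ^ ((q x)⁻¹.toReal * p x) ≤ W) : modular p μ f ≤ W := by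
  obtain ⟨m, ⟨hm₀, hm, hmod⟩, hml⟩ := sInf_lt_iff.1 h
  have hweight : ∀ᵐ x ∂μ, (m ^ (q x)⁻¹.toReal) ^ p x ≤ W := by
    filter_upwards [hp, hlW] with x hpx hx
    rw [← ENNReal.rpow_mul]
    exact (ENNReal.rpow_le_rpow hml.le (by positivity)).trans hx
  calc modular p μ f = modular p μ fun x => m ^ (q x)⁻¹.toReal * (f x / m ^ (q x)⁻¹.toReal) := by
        congr 1 with x
        exact (ENNReal.mul_div_cancel (ENNReal.rpow_pos hm₀ hm.ne).ne'
          (ENNReal.rpow_ne_top_of_nonneg ENNReal.toReal_nonneg hm.ne)).symm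
    _ ≤ W * 1 := (modular_mul_le hp hW hweight).trans (by gcongr)
    _ = W := mul_one W

theorem IsExponent.exists_inv_toReal_mul_le (hq : IsExponent q μ) (hp₀ : ∀ᵐ x ∂μ, 0 ≤ p x) {M : ℝ}
    (hp : ∀ᵐ x ∂μ, p x ≤ M) : ∃ κ : ℝ, 0 ≤ κ ∧ ∀ᵐ x ∂μ, (q x)⁻¹.toReal * p x ≤ κ := by
  obtain ⟨b, hb₀, hb⟩ := exists_between hq.essInf_pos
  refine ⟨b⁻¹.toReal * max 0 M, by positivity, ?_⟩
  filter_upwards [ae_lt_of_lt_essInf hb, hp₀, hp] with x hbx hx₀ hx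
  gcongr
  · exact ENNReal.inv_ne_top.2 hb₀.ne'
  · exact hx.trans (le_max_right _ _)

variable {κ : ℝ}

theorem modular_le_two_rpow_of_lebNormPow_le_one {f : X → ℝ≥0∞} (hp : ∀ᵐ x ∂μ, 0 ≤ p x)
    (hκ : 0 ≤ κ) (hq : ∀ᵐ x ∂μ, (q x)⁻¹.toReal * p x ≤ κ) (h : lebNormPow p q μ f ≤ 1) :
    modular p μ f ≤ 2 ^ κ :=
  modular_le_of_lebNormPow_lt hp (h.trans_lt ENNReal.one_lt_two)
    (ENNReal.rpow_ne_top_of_nonneg hκ ENNReal.ofNat_ne_top)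
    (hq.mono fun _ hx => ENNReal.rpow_le_rpow_of_exponent_le ENNReal.one_lt_two.le hx)

theorem rpow_le_two_rpow_mul {l : ℝ≥0∞} {e : ℝ} (hl : l ≤ 2) (he : 1 ≤ e) (heκ : e ≤ κ) :
    l ^ e ≤ 2 ^ κ * l := by
  have hl' : l / 2 ≤ 1 := ENNReal.div_le_of_le_mul (by rwa [one_mul])
  calc l ^ e = 2 ^ e * (l / 2) ^ e := by
        rw [← ENNReal.mul_rpow_of_nonneg _ _ (by linarith),
          ENNReal.mul_div_cancel two_ne_zero ENNReal.ofNat_ne_top]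
    _ ≤ 2 ^ κ * (l / 2) := by
        gcongr
        · exact ENNReal.one_lt_two.le
        · exact ENNReal.rpow_le_self_of_le_one hl' he
    _ ≤ 2 ^ κ * l := by gcongr; exact ENNReal.half_le_self

theorem modular_le_mul_lebNormPow {f : X → ℝ≥0∞} (hp : ∀ᵐ x ∂μ, 0 ≤ p x)
    (hκ : 0 ≤ κ) (hq₁ : ∀ᵐ x ∂μ, 1 ≤ (q x)⁻¹.toReal * p x)
    (hq : ∀ᵐ x ∂μ, (q x)⁻¹.toReal * p x ≤ κ) (h : lebNormPow p q μ f ≤ 1) :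
    modular p μ f ≤ 2 ^ κ * lebNormPow p q μ f := by
  have hC : (2 : ℝ≥0∞) ^ κ ≠ ∞ := ENNReal.rpow_ne_top_of_nonneg hκ ENNReal.ofNat_ne_top
  refine ENNReal.le_mul_of_forall_lt (.inr (h.trans_lt ENNReal.one_lt_top).ne) (.inl hC)
    fun C hC' l hl => ?_
  have hl2 : min l 2 ≤ 2 := min_le_right l 2
  calc modular p μ f ≤ 2 ^ κ * min l 2 := by
        refine modular_le_of_lebNormPow_lt hp (lt_min hl (h.trans_lt ENNReal.one_lt_two))
          (ENNReal.mul_ne_top hC (ne_top_of_le_ne_top ENNReal.ofNat_ne_top hl2)) ?_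
        filter_upwards [hq₁, hq] with x hx₁ hx using rpow_le_two_rpow_mul hl2 hx₁ hx
    _ ≤ C * l := by gcongr; exact min_le_left l 2

theorem modular_iSup_nat_le_of_seqLebModular_le_one {g : ℤ → X → ℝ≥0∞} (hp : Measurable p)
    (hp₀ : ∀ᵐ x ∂μ, 0 < p x) (hκ : 0 ≤ κ) (hq₁ : ∀ᵐ x ∂μ, 1 ≤ (q x)⁻¹.toReal * p x)
    (hq : ∀ᵐ x ∂μ, (q x)⁻¹.toReal * p x ≤ κ) (hg : ∀ k, Measurable (g k))
    (h : seqLebModular p q μ g ≤ 1) : modular p μ (fun x => ⨆ k : ℕ, g k x) ≤ 2 ^ κ := by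
  rw [seqLebModular_eq_tsum_lebNormPow] at h
  have hle (k : ℤ) : lebNormPow p q μ (g k) ≤ 1 := (ENNReal.le_tsum k).trans h
  calc modular p μ (fun x => ⨆ k : ℕ, g k x) ≤ ∑' k : ℕ, modular p μ (g k) :=
        modular_iSup_le hp hp₀ fun k => hg k
    _ ≤ ∑' k : ℕ, 2 ^ κ * lebNormPow p q μ (g k) := ENNReal.tsum_le_tsum fun k =>
        modular_le_mul_lebNormPow (hp₀.mono fun _ => le_of_lt) hκ hq₁ hq (hle k)
    _ = 2 ^ κ * ∑' k : ℕ, lebNormPow p q μ (g k) := ENNReal.tsum_mul_left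
    _ ≤ 2 ^ κ * 1 := by
        gcongr
        exact (ENNReal.tsum_comp_le_tsum_of_injective Nat.cast_injective _).trans h
    _ = 2 ^ κ := mul_one _

theorem modular_iSup_nat_geometric_le_of_seqLebModular_le_one {a : ℝ} {r : ℝ≥0∞}
    {g : ℤ → X → ℝ≥0∞} (hp : Measurable p) (ha : 0 < a) (hpa : ∀ᵐ x ∂μ, a ≤ p x) (hκ : 0 ≤ κ)
    (hq : ∀ᵐ x ∂μ, (q x)⁻¹.toReal * p x ≤ κ) (hr : r ≤ 1) (hg : ∀ k, Measurable (g k))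
    (h : seqLebModular p q μ g ≤ 1) :
    modular p μ (fun x => ⨆ k : ℕ, r ^ k * g k x) ≤ (1 - r ^ a)⁻¹ * 2 ^ κ := by
  rw [seqLebModular_eq_tsum_lebNormPow] at h
  have hle (k : ℤ) : lebNormPow p q μ (g k) ≤ 1 := (ENNReal.le_tsum k).trans h
  have hp₀ : ∀ᵐ x ∂μ, 0 < p x := hpa.mono fun _ => ha.trans_le
  exact modular_iSup_geometric_le hp ha hpa hr (fun k => hg k) fun k =>
    modular_le_two_rpow_of_lebNormPow_le_one (hp₀.mono fun _ => le_of_lt) hκ hq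
      (hle k)

end MixedNorms

section Exponents

variable {X : Type*} [MeasurableSpace X] {μ : Measure X}

theorem MuchLess.exists_gap {f g : X → ℝ} (h : MuchLess f g μ) :
    ∃ ε : ℝ, 0 < ε ∧ ∀ᵐ x ∂μ, ε ≤ g x - f x := by
  obtain ⟨ε, hε, hεess⟩ := EReal.lt_iff_exists_real_btwn.1 h
  refine ⟨ε, by exact_mod_cast hε, ?_⟩
  filter_upwards [ae_lt_of_lt_essInf hεess] with x hx
  exact_mod_cast hx.le

theorem MuchLess.mul_right_trans {Q p s t : X → ℝ} (hts : MuchLess t s μ)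
    (hsp : MuchLess (fun x => s x * p x) Q μ) (hp : ∀ᵐ x ∂μ, 0 ≤ p x) :
    MuchLess (fun x => t x * p x) Q μ := by
  obtain ⟨ε, hε, hts⟩ := hts.exists_gap
  obtain ⟨η, hη, hsp⟩ := hsp.exists_gap
  refine (EReal.coe_pos.2 hη).trans_le (le_essInf_of_ae_le _ ?_)
  filter_upwards [hp, hts, hsp] with x hpx htsx hspx
  have : t x * p x ≤ s x * p x := by gcongr; linarith
  exact EReal.coe_le_coe_iff.2 (by linarith)

variable [MetricSpace X]

theorem IsBddLogExponent.exists_bounds {p : X → ℝ} (hp : IsBddLogExponent p μ) :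
    ∃ a M : ℝ, 0 < a ∧ ∀ᵐ x ∂μ, a ≤ p x ∧ p x ≤ M := by
  obtain ⟨a, -, hap⟩ := ENNReal.lt_iff_exists_real_btwn.1 hp.essInf_pos
  obtain ⟨M, hM, hpM, -⟩ := ENNReal.lt_iff_exists_real_btwn.1 hp.essSup_lt_top
  refine ⟨a, M, ENNReal.ofReal_pos.1 hap.1, ?_⟩
  filter_upwards [ae_lt_of_lt_essInf hap.2, ae_lt_of_essSup_lt hpM] with x hax hxM
  exact ⟨((ENNReal.ofReal_lt_ofReal_iff (hp.pos x)).1 hax).le,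
    (ENNReal.ofReal_le_ofReal_iff hM).1 hxM.le⟩

theorem exists_ae_uniformlySubcritical {Q p s : X → ℝ} (hQ : IsBddLogExponent Q μ)
    (hp : IsBddLogExponent p μ) (hs : IsBddLogExponent s μ)
    (hsp : MuchLess (fun x => s x * p x) Q μ) :
    ∃ a M : ℝ, 0 < a ∧ 0 < M ∧ ∀ᵐ x ∂μ, UniformlySubcritical a M (Q x) (p x) (s x) := by
  obtain ⟨_, MQ, -, hQ⟩ := hQ.exists_bounds
  obtain ⟨a, Mp, ha, hp⟩ := hp.exists_bounds
  obtain ⟨_, Ms, -, hs'⟩ := hs.exists_bounds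
  obtain ⟨ε, hε, hsp⟩ := hsp.exists_gap
  refine ⟨min a ε, max 1 (max MQ (max Mp Ms)), lt_min ha hε, lt_max_of_lt_left one_pos, ?_⟩
  filter_upwards [hQ, hp, hs', hsp] with x hQx hpx hsx hgap
  exact
    { pos := lt_min ha hε
      le_p := (min_le_left a ε).trans hpx.1
      p_le := by simp [hpx.2]
      s_pos := hs.pos x
      s_le := by simp [hsx.2]
      Q_le := by simp [hQx.2]
      le_gap := (min_le_right a ε).trans hgap }

end Exponents

variable {X : Type*} [MetricSpace X] [MeasurableSpace X] {μ : Measure X}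

section Sobolev

theorem LowerAhlforsRegular.exists_mem_sublevel {Q : X → ℝ} (hreg : LowerAhlforsRegular Q μ)
    {A : ℝ≥0∞} (hA : A ≠ ∞) :
    ∃ c : ℝ, 1 ≤ c ∧ ∀ f : X → ℝ≥0∞, Measurable f → ∫⁻ x, f x ∂μ ≤ A →
      ∀ T : Set X, (∀ᵐ x ∂μ, x ∈ T) → ∀ x, 0 < Q x → ∀ j : ℕ,
        ∃ y ∈ T, dist x y < 2 ^ (-(j / Q x)) ∧ f y ≤ ENNReal.ofReal (c * 2 ^ j) := by
  obtain ⟨b, hb, hball⟩ := hreg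
  have hA₀ : 0 ≤ (A.toReal + 1) / b := by positivity
  refine ⟨(A.toReal + 1) / b + 1, by linarith, fun f hf hfA T hT x hQ j => ?_⟩
  set c := (A.toReal + 1) / b + 1 with hc
  have hcb : A.toReal < c * b := by
    rw [hc, add_mul, div_mul_cancel₀ _ hb.ne']
    linarith
  set r : ℝ := 2 ^ (-(j / Q x))
  have hr : r ≤ 1 := Real.rpow_le_one_of_one_le_of_nonpos one_le_two
    (neg_nonpos.2 (by positivity))
  have hrQ : r ^ Q x = (2 ^ j)⁻¹ := by
    rw [← Real.rpow_mul zero_le_two, neg_mul, div_mul_cancel₀ _ hQ.ne',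
      Real.rpow_neg zero_le_two, Real.rpow_natCast]
  by_contra! hlarge
  have hsub : Metric.ball x r ⊆ Tᶜ ∪ {y | ENNReal.ofReal (c * 2 ^ j) ≤ f y} := fun y hy =>
    or_iff_not_imp_left.2 fun hyT =>
      (hlarge y (not_not.1 hyT) (Metric.mem_ball'.1 hy)).le
  have hmeas : μ (Metric.ball x r) ≤ μ {y | ENNReal.ofReal (c * 2 ^ j) ≤ f y} := by
    refine (measure_mono hsub).trans ((measure_union_le _ _).trans_eq ?_)
    rw [show μ Tᶜ = 0 from hT, zero_add]
  have hle : ENNReal.ofReal (c * b) ≤ A := calc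
    ENNReal.ofReal (c * b) = ENNReal.ofReal (c * 2 ^ j) * ENNReal.ofReal (b * r ^ Q x) := by
        rw [← ENNReal.ofReal_mul (by positivity), hrQ]
        congr 1
        field_simp
    _ ≤ ENNReal.ofReal (c * 2 ^ j) * μ {y | ENNReal.ofReal (c * 2 ^ j) ≤ f y} := by
        gcongr
        exact (hball x r (by positivity) hr).trans hmeas
    _ ≤ A := (mul_meas_ge_le_lintegral hf _).trans hfA
  exact absurd ((ENNReal.ofReal_le_iff_le_toReal hA).1 hle) hcb.not_ge

/-- Measurable `s(·)`-gradients of `U` at scale one: a single function controls the increments of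
`U` between points at distance less than `1`, outside a null set. -/
def localGradients (s : X → ℝ) (μ : Measure X) (U : X → ℝ) : Set (X → ℝ≥0∞) :=
  {G | Measurable G ∧ ∃ N : Set X, μ N = 0 ∧ ∀ x y, x ∉ N → y ∉ N → dist x y < 1 →
    edist (U x) (U y) ≤
      ENNReal.ofReal (dist x y ^ s x) * G x + ENNReal.ofReal (dist x y ^ s y) * G y}

theorem div_mem_localGradients {s : X → ℝ} {U : X → ℝ} {G : X → ℝ≥0∞} {l : ℝ} (hl : 0 < l)
    (hG : G ∈ localGradients s μ U) :
    (fun x => G x / ENNReal.ofReal l) ∈ localGradients s μ fun x => U x / l := by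
  obtain ⟨hGm, N, hN, hUG⟩ := hG
  refine ⟨hGm.div_const _, N, hN, fun x y hx hy hxy => ?_⟩
  calc edist (U x / l) (U y / l) = edist (U x) (U y) / ENNReal.ofReal l := by
        rw [edist_dist, edist_dist, ← ENNReal.ofReal_div_of_pos hl, Real.dist_eq, Real.dist_eq,
          ← sub_div, abs_div, abs_of_pos hl]
    _ ≤ _ := by
        rw [← mul_div_assoc, ← mul_div_assoc, ENNReal.div_add_div_same]
        exact ENNReal.div_le_div_right (hUG x y hx hy hxy) _

theorem enorm_rpow_add_rpow_eq_ofReal {U p : ℝ} {G : ℝ≥0∞} (hp : 0 ≤ p) (hG : G ≠ ∞) :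
    ‖U‖ₑ ^ p + G ^ p = ENNReal.ofReal (|U| ^ p + G.toReal ^ p) := by
  rw [ENNReal.ofReal_add (by positivity) (by positivity),
    ← ENNReal.ofReal_rpow_of_nonneg (abs_nonneg U) hp,
    ← ENNReal.ofReal_rpow_of_nonneg ENNReal.toReal_nonneg hp, ENNReal.ofReal_toReal hG,
    Real.enorm_eq_ofReal_abs]

theorem abs_sub_le_of_edist_le {u v d s t : ℝ} {g h : ℝ≥0∞} (hd : 0 ≤ d) (hg : g ≠ ∞) (hh : h ≠ ∞)
    (huv : edist u v ≤ ENNReal.ofReal (d ^ s) * g + ENNReal.ofReal (d ^ t) * h) :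
    |u - v| ≤ d ^ s * g.toReal + d ^ t * h.toReal := by
  rwa [edist_dist, Real.dist_eq, ← ENNReal.ofReal_toReal hg, ← ENNReal.ofReal_toReal hh,
    ← ENNReal.ofReal_mul (by positivity), ← ENNReal.ofReal_mul (by positivity),
    ← ENNReal.ofReal_add (by positivity) (by positivity),
    ENNReal.ofReal_le_ofReal_iff (by positivity)] at huv

variable {Q p s : X → ℝ} {A : ℝ≥0∞}

theorem LowerAhlforsRegular.exists_isChainable {a M : ℝ} (hreg : LowerAhlforsRegular Q μ)
    (hpm : Measurable p) (hE : ∀ᵐ x ∂μ, UniformlySubcritical a M (Q x) (p x) (s x)) (hA : A ≠ ∞) :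
    ∃ c : ℝ, 1 ≤ c ∧ ∀ (U : X → ℝ) (G : X → ℝ≥0∞), Measurable U → G ∈ localGradients s μ U →
      modular p μ (fun x => ‖U x‖ₑ) ≤ A → modular p μ G ≤ A →
      ∃ T : Set X, (∀ᵐ x ∂μ, x ∈ T) ∧ (∀ x ∈ T, G x ≠ ∞) ∧
        IsChainable Q p s a M c T U fun x => (G x).toReal := by
  obtain ⟨c, hc, hnear⟩ := hreg.exists_mem_sublevel (ENNReal.add_ne_top.2 ⟨hA, hA⟩)
  refine ⟨c, hc, fun U G hU ⟨hG, N, hN, hUG⟩ hUA hGA => ?_⟩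
  let T := {x | UniformlySubcritical a M (Q x) (p x) (s x) ∧ x ∉ N ∧ G x < ∞}
  have hT : ∀ᵐ x ∂μ, x ∈ T := by
    filter_upwards [hE, measure_eq_zero_iff_ae_notMem.1 hN, ae_lt_top_of_modular_lt_top hpm
      (hE.mono fun x hx => hx.p_pos) hG (hGA.trans_lt hA.lt_top)] with x hEx hxN hGx
    exact ⟨hEx, hxN, hGx⟩
  have hF : Measurable fun x => ‖U x‖ₑ ^ p x + G x ^ p x :=
    (hU.enorm.pow hpm).add (hG.pow hpm)
  have hUGA : ∫⁻ x, (‖U x‖ₑ ^ p x + G x ^ p x) ∂μ ≤ A + A := by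
    rw [lintegral_add_right _ (hG.pow hpm)]
    exact add_le_add hUA hGA
  refine ⟨T, hT, fun x hx => hx.2.2.ne, ?_⟩
  exact
    { subcritical := fun x hx => hx.1
      gradient_nonneg := fun x => ENNReal.toReal_nonneg
      abs_sub_le := fun x hx y hy hxy => abs_sub_le_of_edist_le dist_nonneg hx.2.2.ne hy.2.2.ne
        (hUG x y hx.2.1 hy.2.1 hxy)
      exists_near := fun x hx j => by
        obtain ⟨y, hy, hxy, hle⟩ :=
          hnear _ hF hUGA T hT x hx.1.Q_pos j
        refine ⟨y, hy, hxy, ?_⟩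
        rwa [enorm_rpow_add_rpow_eq_ofReal hy.1.p_pos.le hy.2.2.ne,
          ENNReal.ofReal_le_ofReal_iff (by positivity)] at hle }

theorem LowerAhlforsRegular.exists_modular_sobolevExponent_le (hreg : LowerAhlforsRegular Q μ)
    (hQ : IsBddLogExponent Q μ) (hp : IsBddLogExponent p μ) (hs : IsBddLogExponent s μ)
    (hsp : MuchLess (fun x => s x * p x) Q μ) (hA : A ≠ ∞) :
    ∃ B : ℝ≥0∞, B ≠ ∞ ∧ ∀ (U : X → ℝ) (G : X → ℝ≥0∞), Measurable U → G ∈ localGradients s μ U →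
      modular p μ (fun x => ‖U x‖ₑ) ≤ A → modular p μ G ≤ A →
      modular (fun x => sobolevExponent (Q x) (p x) (s x)) μ (fun x => ‖U x‖ₑ) ≤ B := by
  obtain ⟨a, M, ha, hM, hE⟩ := exists_ae_uniformlySubcritical hQ hp hs hsp
  obtain ⟨c, hc, hchain⟩ := hreg.exists_isChainable hp.measurable hE hA
  obtain ⟨K, hK, hpoint⟩ :=
    exists_rpow_sobolevExponent_le hQ.logHolder hp.logHolder hs.logHolder ha hM hc
  refine ⟨ENNReal.ofReal K * (A + A), by finiteness, fun U G hU hG hUA hGA => ?_⟩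
  obtain ⟨T, hT, hfin, hT'⟩ := hchain U G hU hG hUA hGA
  have hbound : ∀ᵐ x ∂μ, ‖U x‖ₑ ^ sobolevExponent (Q x) (p x) (s x) ≤
      ENNReal.ofReal K * (‖U x‖ₑ ^ p x + G x ^ p x) := by
    filter_upwards [hT] with x hx
    have hEx := hT'.subcritical x hx
    rw [enorm_rpow_add_rpow_eq_ofReal hEx.p_pos.le (hfin x hx), ← ENNReal.ofReal_mul hK,
      Real.enorm_eq_ofReal_abs,
      ENNReal.ofReal_rpow_of_nonneg (abs_nonneg _) hEx.sobolevExponent_pos.le]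
    exact ENNReal.ofReal_le_ofReal (hpoint T U _ hT' x hx)
  calc modular (fun x => sobolevExponent (Q x) (p x) (s x)) μ (fun x => ‖U x‖ₑ)
      ≤ ∫⁻ x, ENNReal.ofReal K * (‖U x‖ₑ ^ p x + G x ^ p x) ∂μ := lintegral_mono_ae hbound
    _ = ENNReal.ofReal K * (modular p μ (fun x => ‖U x‖ₑ) + modular p μ G) := by
        rw [lintegral_const_mul' _ _ ENNReal.ofReal_ne_top,
          lintegral_add_right _ (hG.1.pow hp.measurable), modular, modular]
    _ ≤ ENNReal.ofReal K * (A + A) := by gcongr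

theorem enorm_toReal_div {v : EReal} (hv : v ≠ ⊥ ∧ v ≠ ⊤) {L : ℝ≥0∞} (hL : L ≠ 0) (hL' : L ≠ ∞) :
    ‖v.toReal / L.toReal‖ₑ = v.abs / L := by
  lift v to ℝ using hv.symm
  have hl : 0 < L.toReal := ENNReal.toReal_pos hL hL'
  rw [EReal.toReal_coe, EReal.abs_def, Real.enorm_eq_ofReal_abs, abs_div, abs_of_pos hl,
    ENNReal.ofReal_div_of_pos hl, ENNReal.ofReal_toReal hL']

theorem LowerAhlforsRegular.continuouslyEmbeds_of_localGradients (hreg : LowerAhlforsRegular Q μ)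
    (hQ : IsBddLogExponent Q μ) (hp : IsBddLogExponent p μ) (hs : IsBddLogExponent s μ)
    (hsp : MuchLess (fun x => s x * p x) Q μ) {E : Set (X → EReal)}
    {hom : (X → EReal) → ℝ≥0∞} (hA : A ≠ ∞)
    (hE : ∀ u ∈ E, u ∈ lpSpace p μ ∧ (∀ᵐ x ∂μ, u x ≠ ⊥ ∧ u x ≠ ⊤) ∧ hom u < ∞)
    (hgrad : ∀ u ∈ E, ∀ L, hom u < L →
      ∃ G ∈ localGradients s μ fun x => (u x).toReal, modular p μ (fun x => G x / L) ≤ A) :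
    ContinuouslyEmbeds E (fun u => lpNorm p μ u + hom u)
      (lpSpace (fun x => sobolevExponent (Q x) (p x) (s x)) μ)
      (lpNorm (fun x => sobolevExponent (Q x) (p x) (s x)) μ) := by
  obtain ⟨a, M, ha, hM, hsub⟩ := exists_ae_uniformlySubcritical hQ hp hs hsp
  obtain ⟨B, hB, hsobolev⟩ := hreg.exists_modular_sobolevExponent_le hQ hp hs hsp
    (max_lt ENNReal.one_lt_top hA.lt_top).ne
  refine continuouslyEmbeds_lpSpace_of_modular_div_le ha
    (hsub.mono fun x hx => hx.le_p.trans hx.le_sobolevExponent) (by positivity)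
    (hsub.mono fun x hx => hx.sobolevExponent_le) hB (fun u hu => (hE u hu).1.1)
    (fun u hu => ENNReal.add_lt_top.2 ⟨lebNorm_lt_top ha (hsub.mono fun x hx => hx.le_p)
      (hE u hu).1.2, (hE u hu).2.2⟩) fun u hu L hL hL' => ?_
  obtain ⟨hup, hfin, -⟩ := hE u hu
  obtain ⟨G, hG, hGA⟩ := hgrad u hu L (le_add_self.trans_lt hL)
  have hL₀ : L ≠ 0 := hL.bot_lt.ne'
  have huL : (fun x => ‖(u x).toReal / L.toReal‖ₑ) =ᵐ[μ] fun x => (u x).abs / L :=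
    hfin.mono fun x hx => enorm_toReal_div hx hL₀ hL'.ne
  have hG' := div_mem_localGradients (ENNReal.toReal_pos hL₀ hL'.ne) hG
  rw [ENNReal.ofReal_toReal hL'.ne] at hG'
  have hp₀ : ∀ᵐ x ∂μ, 0 ≤ p x := .of_forall fun x => (hp.pos x).le
  have hup' : modular p μ (fun x => (u x).abs / L) ≤ 1 :=
    modular_div_le_one_of_lebNorm_lt hp₀ (le_self_add.trans_lt hL)
  exact (modular_mono_ae (hsub.mono fun x hx => hx.sobolevExponent_pos.le) huL.symm.le).trans
    (hsobolev _ _ (hup.1.ereal_toReal.div_const _) hG'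
      ((modular_mono_ae hp₀ huL.le).trans (hup'.trans (le_max_left 1 A)))
      (hGA.trans (le_max_right 1 A)))

end Sobolev

section VectorGradients

theorem exists_nat_dyadic_scale {d : ℝ} (hd : 0 < d) (hd' : d < 1) :
    ∃ k : ℕ, (2 : ℝ) ^ (-(k : ℤ) - 1) ≤ d ∧ d < (2 : ℝ) ^ (-(k : ℤ)) := by
  obtain ⟨n, hnd, hdn⟩ := exists_mem_Ico_zpow hd (one_lt_two (α := ℝ))
  have hn : n < 0 := (zpow_lt_one_iff_right₀ (one_lt_two (α := ℝ))).1 (hnd.trans_lt hd')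
  obtain ⟨k, hk⟩ := Int.eq_ofNat_of_zero_le (show 0 ≤ -n - 1 by lia)
  refine ⟨k, ?_, ?_⟩
  · rwa [show -(k : ℤ) - 1 = n by lia]
  · rwa [show -(k : ℤ) = n + 1 by lia]

theorem rpow_le_rpow_mul_two_rpow_neg_pow {d s t ε : ℝ} {k : ℕ} (hd : 0 < d) (hd' : d ≤ 1)
    (hk : d ≤ 2 ^ (-(k : ℤ))) (hε : 0 ≤ ε) (hts : ε ≤ s - t) :
    d ^ s ≤ d ^ t * (2 ^ (-ε)) ^ k := calc
  d ^ s = d ^ t * d ^ (s - t) := by rw [← Real.rpow_add hd, add_sub_cancel]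
  _ ≤ d ^ t * d ^ ε := by
      gcongr ?_ * ?_
      exact Real.rpow_le_rpow_of_exponent_ge hd hd' hts
  _ ≤ d ^ t * (2 ^ (-(k : ℤ))) ^ ε := by gcongr
  _ = d ^ t * (2 ^ (-ε)) ^ k := by
      rw [← Real.rpow_natCast, ← Real.rpow_mul zero_le_two, ← Real.rpow_intCast,
        ← Real.rpow_mul zero_le_two]
      push_cast
      ring_nf

variable {s t : X → ℝ} {u : X → EReal} {g : ℤ → X → ℝ≥0∞}

theorem edist_toReal_toReal {v w : EReal} (hv : v ≠ ⊥ ∧ v ≠ ⊤) (hw : w ≠ ⊥ ∧ w ≠ ⊤) :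
    edist v.toReal w.toReal = (v - w).abs := by
  lift v to ℝ using hv.symm
  lift w to ℝ using hw.symm
  rw [← EReal.coe_sub, EReal.abs_def, edist_dist, Real.dist_eq, EReal.toReal_coe,
    EReal.toReal_coe]

theorem iSup_geometric_mul_mem_localGradients {ε : ℝ} (hε : 0 ≤ ε)
    (hts : ∀ᵐ x ∂μ, ε ≤ s x - t x) (hu : ∀ᵐ x ∂μ, u x ≠ ⊥ ∧ u x ≠ ⊤)
    (hg : g ∈ vectorGradients s μ u) :
    (fun x => ⨆ k : ℕ, ENNReal.ofReal (2 ^ (-ε)) ^ k * g k x) ∈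
      localGradients t μ fun x => (u x).toReal := by
  obtain ⟨hgm, N, hN, hgrad⟩ := hg
  refine ⟨.iSup fun k => (hgm k).const_mul _, N ∪ {x | ¬(ε ≤ s x - t x ∧ u x ≠ ⊥ ∧ u x ≠ ⊤)},
    measure_union_null hN (hts.and hu), fun x y hx hy hxy => ?_⟩
  obtain ⟨hxN, htx, hux⟩ : x ∉ N ∧ ε ≤ s x - t x ∧ u x ≠ ⊥ ∧ u x ≠ ⊤ := by simpa using hx
  obtain ⟨hyN, hty, huy⟩ : y ∉ N ∧ ε ≤ s y - t y ∧ u y ≠ ⊥ ∧ u y ≠ ⊤ := by simpa using hy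
  rcases eq_or_ne x y with rfl | hne
  · rw [edist_self]
    exact zero_le
  have hd : 0 < dist x y := dist_pos.2 hne
  obtain ⟨k, hk, hk'⟩ := exists_nat_dyadic_scale hd hxy
  have hterm (z : X) (hz : ε ≤ s z - t z) : ENNReal.ofReal (dist x y ^ s z) * g k z ≤
      ENNReal.ofReal (dist x y ^ t z) * ⨆ k : ℕ, ENNReal.ofReal (2 ^ (-ε)) ^ k * g k z := calc
    ENNReal.ofReal (dist x y ^ s z) * g k z
      ≤ ENNReal.ofReal (dist x y ^ t z * (2 ^ (-ε)) ^ k) * g k z := by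
        gcongr
        exact rpow_le_rpow_mul_two_rpow_neg_pow hd hxy.le hk'.le hε hz
    _ = ENNReal.ofReal (dist x y ^ t z) * (ENNReal.ofReal (2 ^ (-ε)) ^ k * g k z) := by
        rw [ENNReal.ofReal_mul (by positivity), ENNReal.ofReal_pow (by positivity), mul_assoc]
    _ ≤ _ := by
        gcongr
        exact le_iSup (fun k : ℕ => ENNReal.ofReal (2 ^ (-ε)) ^ k * g k z) k
  calc edist (u x).toReal (u y).toReal = (u x - u y).abs := edist_toReal_toReal hux huy
    _ ≤ _ := (hgrad k x y hxN hyN hk hk').trans (add_le_add (hterm x htx) (hterm y hty))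

theorem iSup_mem_localGradients (hu : ∀ᵐ x ∂μ, u x ≠ ⊥ ∧ u x ≠ ⊤)
    (hg : g ∈ vectorGradients s μ u) :
    (fun x => ⨆ k : ℕ, g k x) ∈ localGradients s μ fun x => (u x).toReal := by
  simpa using iSup_geometric_mul_mem_localGradients le_rfl (by simp) hu hg

end VectorGradients

section Embeddings

variable {Q p s t : X → ℝ} {q : X → ℝ≥0∞}

theorem one_le_inv_toReal_mul {q : ℝ≥0∞} {p : ℝ} (hq : 0 < q) (hqp : q ≤ ENNReal.ofReal p) :
    1 ≤ q⁻¹.toReal * p := by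
  have hq' : 0 < q.toReal :=
    ENNReal.toReal_pos hq.ne' (ne_top_of_le_ne_top ENNReal.ofReal_ne_top hqp)
  have hp : 0 ≤ p := (ENNReal.ofReal_pos.1 (hq.trans_le hqp)).le
  rw [ENNReal.toReal_inv, ← div_eq_inv_mul, one_le_div hq']
  exact ENNReal.toReal_le_of_le_ofReal hp hqp

theorem LowerAhlforsRegular.tlSpace_continuouslyEmbeds (hreg : LowerAhlforsRegular Q μ)
    (hQ : IsBddLogExponent Q μ) (hp : IsBddLogExponent p μ) (hs : IsBddLogExponent s μ)
    (hsp : MuchLess (fun x => s x * p x) Q μ) (hq : ∀ x, 0 < q x) :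
    ContinuouslyEmbeds (TLSpace s p q μ) (tlNorm s p q μ)
      (lpSpace (fun x => sobolevExponent (Q x) (p x) (s x)) μ)
      (lpNorm (fun x => sobolevExponent (Q x) (p x) (s x)) μ) := by
  have hp₀ : ∀ᵐ x ∂μ, 0 ≤ p x := .of_forall fun x => (hp.pos x).le
  refine hreg.continuouslyEmbeds_of_localGradients hQ hp hs hsp ENNReal.one_ne_top
    (fun u hu => ⟨hu.2, hu.1.2⟩) fun u hu L hL => ?_
  simp only [homTLNorm, iInf_lt_iff] at hL
  obtain ⟨g, hg, hgL⟩ := hL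
  refine ⟨_, iSup_mem_localGradients hu.1.2.1 hg, le_trans ?_
    (modular_div_le_one_of_lebNorm_lt hp₀ hgL)⟩
  exact modular_mono_ae hp₀ (.of_forall fun x => ENNReal.div_le_div_right
    (iSup_le fun k : ℕ => le_seqNorm (hq x) g k) L)

theorem LowerAhlforsRegular.besovSpace_continuouslyEmbeds_of_le (hreg : LowerAhlforsRegular Q μ)
    (hQ : IsBddLogExponent Q μ) (hp : IsBddLogExponent p μ) (hs : IsBddLogExponent s μ)
    (hsp : MuchLess (fun x => s x * p x) Q μ) (hq : IsExponent q μ)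
    (hqp : ∀ x, q x ≤ ENNReal.ofReal (p x)) :
    ContinuouslyEmbeds (BesovSpace s p q μ) (besovNorm s p q μ)
      (lpSpace (fun x => sobolevExponent (Q x) (p x) (s x)) μ)
      (lpNorm (fun x => sobolevExponent (Q x) (p x) (s x)) μ) := by
  have hp₀ : ∀ᵐ x ∂μ, 0 < p x := .of_forall hp.pos
  obtain ⟨a, M, -, hpM⟩ := hp.exists_bounds
  obtain ⟨κ, hκ, hqκ⟩ :=
    hq.exists_inv_toReal_mul_le (hp₀.mono fun _ => le_of_lt) (hpM.mono fun _ hx => hx.2)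
  refine hreg.continuouslyEmbeds_of_localGradients hQ hp hs hsp
    (ENNReal.rpow_ne_top_of_nonneg hκ (ENNReal.ofNat_ne_top (n := 2)))
    (fun u hu => ⟨hu.2, hu.1.2⟩) fun u hu L hL => ?_
  simp only [homBesovNorm, iInf_lt_iff] at hL
  obtain ⟨g, hg, hgL⟩ := hL
  refine ⟨_, iSup_mem_localGradients hu.1.2.1 hg, ?_⟩
  simp only [ENNReal.iSup_div]
  exact modular_iSup_nat_le_of_seqLebModular_le_one hp.measurable hp₀ hκ
    (.of_forall fun x => one_le_inv_toReal_mul (hq.pos x) (hqp x)) hqκ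
    (fun k => (hg.1 k).div_const L)
    (seqLebModular_div_le_one_of_seqLebNorm_lt (hp₀.mono fun _ => le_of_lt) hgL)

theorem LowerAhlforsRegular.besovSpace_continuouslyEmbeds_of_muchLess
    (hreg : LowerAhlforsRegular Q μ) (hQ : IsBddLogExponent Q μ) (hp : IsBddLogExponent p μ)
    (ht : IsBddLogExponent t μ) (hsp : MuchLess (fun x => s x * p x) Q μ)
    (hts : MuchLess t s μ) (hq : IsExponent q μ) :
    ContinuouslyEmbeds (BesovSpace s p q μ) (besovNorm s p q μ)
      (lpSpace (fun x => sobolevExponent (Q x) (p x) (t x)) μ)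
      (lpNorm (fun x => sobolevExponent (Q x) (p x) (t x)) μ) := by
  have hp₀ : ∀ᵐ x ∂μ, 0 ≤ p x := .of_forall fun x => (hp.pos x).le
  have htp := hts.mul_right_trans hsp hp₀
  obtain ⟨a, M, ha, hpM⟩ := hp.exists_bounds
  obtain ⟨ε, hε, hts⟩ := hts.exists_gap
  obtain ⟨κ, hκ, hqκ⟩ := hq.exists_inv_toReal_mul_le hp₀ (hpM.mono fun _ hx => hx.2)
  have hr : ENNReal.ofReal (2 ^ (-ε)) < 1 :=
    ENNReal.ofReal_lt_one.2 (Real.rpow_lt_one_of_one_lt_of_neg one_lt_two (neg_neg_of_pos hε))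
  have hA : (1 - ENNReal.ofReal (2 ^ (-ε)) ^ a)⁻¹ * 2 ^ κ ≠ ∞ := ENNReal.mul_ne_top
    (ENNReal.inv_ne_top.2 (tsub_pos_of_lt (ENNReal.rpow_lt_one hr ha)).ne')
    (ENNReal.rpow_ne_top_of_nonneg hκ ENNReal.ofNat_ne_top)
  refine hreg.continuouslyEmbeds_of_localGradients hQ hp ht htp hA
    (fun u hu => ⟨hu.2, hu.1.2⟩) fun u hu L hL => ?_
  simp only [homBesovNorm, iInf_lt_iff] at hL
  obtain ⟨g, hg, hgL⟩ := hL
  refine ⟨_, iSup_geometric_mul_mem_localGradients hε.le hts hu.1.2.1 hg, ?_⟩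
  simp only [ENNReal.iSup_div, mul_div_assoc]
  exact modular_iSup_nat_geometric_le_of_seqLebModular_le_one hp.measurable ha
    (hpM.mono fun _ hx => hx.1) hκ hqκ hr.le (fun k => (hg.1 k).div_const L)
    (seqLebModular_div_le_one_of_seqLebNorm_lt hp₀ hgL)

end Embeddings

end VarHajlasz

theorem mainTheorem6_general {X : Type*} [MetricSpace X] [MeasurableSpace X]
    (μ : Measure X) (Q p s : X → ℝ)
    (hQ : VarHajlasz.IsBddLogExponent Q μ)
    (hreg : VarHajlasz.LowerAhlforsRegular Q μ)
    (hp : VarHajlasz.IsBddLogExponent p μ)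
    (hs : VarHajlasz.IsBddLogExponent s μ)
    (hspQ : VarHajlasz.MuchLess (fun x => s x * p x) Q μ) :
    (∀ q : X → ℝ≥0∞, VarHajlasz.IsExponent q μ →
      VarHajlasz.ContinuouslyEmbeds
        (VarHajlasz.TLSpace s p q μ) (VarHajlasz.tlNorm s p q μ)
        (VarHajlasz.lpSpace (fun x => Q x * p x / (Q x - s x * p x)) μ)
        (VarHajlasz.lpNorm (fun x => Q x * p x / (Q x - s x * p x)) μ)) ∧
    (∀ q : X → ℝ≥0∞, VarHajlasz.IsExponent q μ → (∀ x, q x ≤ ENNReal.ofReal (p x)) →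
      VarHajlasz.ContinuouslyEmbeds
        (VarHajlasz.BesovSpace s p q μ) (VarHajlasz.besovNorm s p q μ)
        (VarHajlasz.lpSpace (fun x => Q x * p x / (Q x - s x * p x)) μ)
        (VarHajlasz.lpNorm (fun x => Q x * p x / (Q x - s x * p x)) μ)) ∧
    (∀ (q : X → ℝ≥0∞) (t : X → ℝ), VarHajlasz.IsExponent q μ →
      VarHajlasz.IsBddLogExponent t μ → VarHajlasz.MuchLess t s μ →
      VarHajlasz.ContinuouslyEmbeds
        (VarHajlasz.BesovSpace s p q μ) (VarHajlasz.besovNorm s p q μ)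
        (VarHajlasz.lpSpace (fun x => Q x * p x / (Q x - t x * p x)) μ)
        (VarHajlasz.lpNorm (fun x => Q x * p x / (Q x - t x * p x)) μ)) :=
  ⟨fun _ hq => hreg.tlSpace_continuouslyEmbeds hQ hp hs hspQ hq.pos,
    fun _ hq hqp => hreg.besovSpace_continuouslyEmbeds_of_le hQ hp hs hspQ hq hqp,
    fun _ _ hq ht hts => hreg.besovSpace_continuouslyEmbeds_of_muchLess hQ hp ht hspQ hts hq⟩

theorem mainTheorem6 {X : Type*} [MetricSpace X] [MeasurableSpace X] [BorelSpace X]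
    (μ : Measure X) (hμ : VarHajlasz.IsMetricMeasureSpace μ)
    (hX : VarHajlasz.GeometricallyDoubling X)
    (hδ : ∃ δ : ℝ, 0 < δ ∧ (⨆ x : X, μ (Metric.ball x δ)) < ∞)
    (Q p s : X → ℝ)
    (hQ : VarHajlasz.IsBddLogExponent Q μ)
    (hreg : VarHajlasz.LowerAhlforsRegular Q μ)
    (hp : VarHajlasz.IsBddLogExponent p μ)
    (hs : VarHajlasz.IsBddLogExponent s μ)
    (hspQ : VarHajlasz.MuchLess (fun x => s x * p x) Q μ) :
    (∀ q : X → ℝ≥0∞, VarHajlasz.IsExponent q μ →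
      VarHajlasz.ContinuouslyEmbeds
        (VarHajlasz.TLSpace s p q μ) (VarHajlasz.tlNorm s p q μ)
        (VarHajlasz.lpSpace (fun x => Q x * p x / (Q x - s x * p x)) μ)
        (VarHajlasz.lpNorm (fun x => Q x * p x / (Q x - s x * p x)) μ)) ∧
    (∀ q : X → ℝ≥0∞, VarHajlasz.IsExponent q μ → (∀ x, q x ≤ ENNReal.ofReal (p x)) →
      VarHajlasz.ContinuouslyEmbeds
        (VarHajlasz.BesovSpace s p q μ) (VarHajlasz.besovNorm s p q μ)
        (VarHajlasz.lpSpace (fun x => Q x * p x / (Q x - s x * p x)) μ)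
        (VarHajlasz.lpNorm (fun x => Q x * p x / (Q x - s x * p x)) μ)) ∧
    (∀ (q : X → ℝ≥0∞) (t : X → ℝ), VarHajlasz.IsExponent q μ →
      VarHajlasz.IsBddLogExponent t μ → VarHajlasz.MuchLess t s μ →
      VarHajlasz.ContinuouslyEmbeds
        (VarHajlasz.BesovSpace s p q μ) (VarHajlasz.besovNorm s p q μ)
        (VarHajlasz.lpSpace (fun x => Q x * p x / (Q x - t x * p x)) μ)
        (VarHajlasz.lpNorm (fun x => Q x * p x / (Q x - t x * p x)) μ)) :=
  mainTheorem6_general μ Q p s hQ hreg hp hs hspQ
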